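/- **Definitions.** For a function $f$, let $\partial_z f,\partial_{\bar z}f$ be its Wirtinger derivatives and $J_f=|\partial_z f|^2-|\partial_{\bar z}f|^2$ its Jacobian. A *non-degenerate harmonic mapping* is a complex-valued harmonic function $f$ on $\Omega=\mathbb C\setminus S$, where $S$ is a finite set of poles of $f$ (i.e. $\lim_{z\to z_0}f(z)=\infty$ for $z_0\in S$), such that near each $z_0\in S$ $$f(z)=\sum_{k=-n}^\infty a_k(z-z_0)^k+\overline{\sum_{k=-n}^\infty b_k(z-z_0)^k}+c\log|z-z_0|$$ with some $n\ge 1$, $c\in\mathbb C$ and $|a_{-n}|\neq|b_{-n}|$, and such that $J_f(z)>0$ for all sufficiently large $|z|$. Let $\mathcal C=\{z\in\Omega: J_f(z)=0\}$ be the critical set, $\omega=\overline{\partial_{\bar z}f}/\partial_z f$ the second complex dilatation (a meromorphic function on $\Omega$, with removable singularities removed), and $\mathcal M=\{z\in\mathcal C:|\omega(z)|\ne 1\}$. The set $\mathcal C$ is bounded, so $\mathbb C\setminus\mathcal C$ has exactly one unbounded connected component $A_\infty$. For a closed curve $\gamma$ and a point $\eta$ not on it, $\mathrm{wn}(\gamma;\eta)$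 is the winding number. The Poincaré index $\mathrm{ind}(g;z_0)$ of a function $g$ that is continuous and non-zero in a punctured neighborhood of $z_0\in\mathbb C$ is the winding number about $0$ of $g\circ\gamma$, where $\gamma$ is a small positively oriented circle about $z_0$. If $g$ is continuous and non-zero for all sufficiently large $|z|$, then $\mathrm{ind}(g;\infty)$ is the winding number about $0$ of $g\circ\gamma$, where $\gamma$ is a large negatively oriented circle about $0$. **Theorem.** Let $f$ be a non-degenerate harmonic mapping, $\eta\in\mathbb C$, and let $A$ be a connected component of $\mathbb C\setminus\mathcal C$ such that $f-\eta$ has no zero on $\partial A$. If $A=A_\infty$, assume also that $f(z)\ne\eta$ for all sufficiently large $|z|$, so that $\mathrm{ind}(f-\eta;\infty)$ is defined. Let $\gamma_j:[a_j,b_j]\to\mathbb C$, $a_j<b_j$, $j=1,\dots,n$ (where $n\ge0$), be closed curves parametrizing $\partial A\setminus\mathcal M$ according to $\omega(\gamma_j(t))=e^{it}$ and traveling through every critical arc once, that is: the union of their traces is $\partial A\setminus\mathcal M$, and each $z\in\partial A\setminus\mathcal M$ with $\omega'(z)\ne0$ equals $\gamma_j(t)$ for exactly one pair $(j,t)$ with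 $t\in[a_j,b_j)$. Let $P(f;A)=\sum_{z\in S\cap A}|\mathrm{ind}(f;z)|$. Then the number $N_\eta(f;A)$ of distinct pre-images of $\eta$ under $f$ in $A$ is finite, and $$N_\eta(f;A)=\begin{cases}\displaystyle\sum_{j=1}^n \mathrm{wn}(f\circ\gamma_j;\eta)+P(f;A) & \text{if } A\ne A_\infty,\\[2mm] \displaystyle\sum_{j=1}^n \mathrm{wn}(f\circ\gamma_j;\eta)+P(f;A)-\mathrm{ind}(f-\eta;\infty) & \text{if } A=A_\infty.\end{cases}$$ -/

import Mathlib

open Filter Topology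

namespace HarmonicCount

noncomputable section

/-- The Wirtinger derivative `∂f/∂z = (∂f/∂x - i ∂f/∂y) / 2`. -/
def dz (f : ℂ → ℂ) (z : ℂ) : ℂ :=
  (fderiv ℝ f z 1 - Complex.I * fderiv ℝ f z Complex.I) / 2

/-- The Wirtinger derivative `∂f/∂z̄ = (∂f/∂x + i ∂f/∂y) / 2`. -/
def dzbar (f : ℂ → ℂ) (z : ℂ) : ℂ :=
  (fderiv ℝ f z 1 + Complex.I * fderiv ℝ f z Complex.I) / 2

/-- The Jacobian `J_f = |∂f/∂z|² - |∂f/∂z̄|²`. -/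
def jacobian (f : ℂ → ℂ) (z : ℂ) : ℝ := ‖dz f z‖ ^ 2 - ‖dzbar f z‖ ^ 2

/-- `f` is a non-degenerate harmonic mapping whose set of poles is `S`; the values of `f` at the
points of `S` play no role. At a pole, the Laurent series of the two analytic parts starting with
the exponent `-n` are written as `(z - z₀)⁻ⁿ` times functions analytic at `z₀`, so that `H z₀` and
`G z₀` are the coefficients `a₋ₙ` and `b₋ₙ`. -/
structure NonDegenerate (f : ℂ → ℂ) (S : Finset ℂ) : Prop where
  harmonic : InnerProductSpace.HarmonicOnNhd f {z | z ∉ S}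
  pole : ∀ z₀ ∈ S, Tendsto f (𝓝[≠] z₀) (Bornology.cobounded ℂ)
  pole_form : ∀ z₀ ∈ S, ∃ (n : ℕ) (H G : ℂ → ℂ) (c : ℂ), 1 ≤ n ∧
    AnalyticAt ℂ H z₀ ∧ AnalyticAt ℂ G z₀ ∧ ‖H z₀‖ ≠ ‖G z₀‖ ∧
    ∀ᶠ z in 𝓝[≠] z₀,
      f z = H z / (z - z₀) ^ n + (starRingEnd ℂ) (G z / (z - z₀) ^ n)
        + c * (Real.log ‖z - z₀‖ : ℂ)
  sense_preserving_infty : ∀ᶠ z in Bornology.cobounded ℂ, 0 < jacobian f z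

/-- The critical set `𝒞` of a harmonic mapping `f` defined off `S`. -/
def critSet (f : ℂ → ℂ) (S : Finset ℂ) : Set ℂ := {z | z ∉ S ∧ jacobian f z = 0}

open Classical in
/-- The second complex dilatation `ω = conj (∂f/∂z̄) / (∂f/∂z)` with removable singularities
removed, i.e. the limit of this quotient at each point where it exists. At a pole of `ω`, where
`|ω| = ∞`, the value is `0`; this is harmless, as `ω` is only used through the conditions
`|ω| = 1` and `ω = exp (i t)`. -/
def dilatation (f : ℂ → ℂ) (z : ℂ) : ℂ :=
  if h : ∃ w : ℂ, Tendsto (fun ζ => (starRingEnd ℂ) (dzbar f ζ) / dz f ζ) (𝓝[≠] z) (𝓝 w)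
  then h.choose else 0

/-- The set `ℳ` of critical points with `|ω| ≠ 1`. -/
def exceptSet (f : ℂ → ℂ) (S : Finset ℂ) : Set ℂ := {z ∈ critSet f S | ‖dilatation f z‖ ≠ 1}

/-- `A` is one of the connected components of `ℂ ∖ 𝒞` (poles of `f` are not removed). -/
def IsTile (f : ℂ → ℂ) (S : Finset ℂ) (A : Set ℂ) : Prop :=
  ∃ z ∈ (critSet f S)ᶜ, A = connectedComponentIn (critSet f S)ᶜ z

/-- `θ` is a continuous argument of the nowhere vanishing function `g` on `[a, b]`. -/
def IsArgumentOn (g : ℝ → ℂ) (a b : ℝ) (θ : ℝ → ℝ) : Prop :=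
  ContinuousOn θ (Set.Icc a b) ∧
    ∀ t ∈ Set.Icc a b, g t ≠ 0 ∧ g t = (‖g t‖ : ℂ) * Complex.exp (θ t * Complex.I)

open Classical in
/-- The winding of `g : [a, b] → ℂ ∖ {0}` about `0`: the change of a continuous argument of `g`
from `a` to `b`, divided by `2π` (and `0` if `g` has no continuous argument). -/
def winding (g : ℝ → ℂ) (a b : ℝ) : ℝ :=
  if h : ∃ θ : ℝ → ℝ, IsArgumentOn g a b θ
  then (h.choose b - h.choose a) / (2 * Real.pi) else 0

/-- The winding number of the closed curve `c : [a, b] → ℂ` about `η`. -/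
def windingNumber (c : ℝ → ℂ) (a b : ℝ) (η : ℂ) : ℝ := winding (fun t => c t - η) a b

/-- The Poincaré index of `f` at an isolated exceptional point `z₀`: the winding of `f` on small
positively oriented circles about `z₀` (eventually independent of the radius). -/
def poincareIndex (f : ℂ → ℂ) (z₀ : ℂ) : ℝ :=
  limUnder (𝓝[>] (0 : ℝ)) fun r => winding (fun t => f (circleMap z₀ r t)) 0 (2 * Real.pi)

/-- The Poincaré index of `f` at `∞`: the winding of `f` on large negatively oriented circles
about the origin (eventually independent of the radius). -/
def poincareIndexInfty (f : ℂ → ℂ) : ℝ :=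
  limUnder atTop fun R : ℝ => winding (fun t => f (circleMap 0 R (-t))) 0 (2 * Real.pi)

open Classical in
/-- `P(f; A)`: the sum of `|ind(f; z)|` over the poles `z` of `f` in `A`. -/
def poleCount (f : ℂ → ℂ) (S : Finset ℂ) (A : Set ℂ) : ℝ :=
  ∑ z ∈ S with z ∈ A, |poincareIndex f z|

/-- `N_η(f; A)` counts this set: the pre-images of `η` under `f` in `A`. -/
def preimages (f : ℂ → ℂ) (S : Finset ℂ) (A : Set ℂ) (η : ℂ) : Set ℂ :=
  {z ∈ A | z ∉ S ∧ f z = η}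

/-- The closed curves `γ j : [a j, b j] → ℂ` parametrize `B`, a union of critical arcs, according
to `ω (γ (t)) = exp (i t)` and travel through every arc once: arcs end only at zeros of `ω'`, and
every other point of `B` is passed exactly once. -/
structure IsCritParam (f : ℂ → ℂ) (B : Set ℂ) {n : ℕ} (a b : Fin n → ℝ)
    (γ : Fin n → ℝ → ℂ) : Prop where
  lt : ∀ j, a j < b j
  continuousOn : ∀ j, ContinuousOn (γ j) (Set.Icc (a j) (b j))
  closed : ∀ j, γ j (a j) = γ j (b j)
  dilatation_eq : ∀ j, ∀ t ∈ Set.Icc (a j) (b j),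
    dilatation f (γ j t) = Complex.exp (t * Complex.I)
  trace_eq : ⋃ j, γ j '' Set.Icc (a j) (b j) = B
  once : ∀ z ∈ B, deriv (dilatation f) z ≠ 0 →
    ∃! p : Fin n × ℝ, p.2 ∈ Set.Ico (a p.1) (b p.1) ∧ γ p.1 p.2 = z

end

end HarmonicCount

/-! Let `σ` be the sign of the Jacobian on the tile `A`. On the closure of `A`, the function `f - η`
has index `σ` at each pre-image of `η` in `A` and index `-σ |ind f|` at each pole in `A`. As `t`
increases, `ω ∘ γ j` runs counterclockwise along the unit circle, so that `{|ω| < 1}`, where the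
Jacobian is positive, lies to the left of `γ j`. Hence crossing a critical arc into `A` changes the
total winding number of the curves by `σ`. As the plane minus finitely many points is connected,
this number is `c + σ` at all points of `A` and a constant `c` at all points off its closure. Far
from the curves it vanishes. If `A` is bounded, this gives `c = 0`, and a homological argument
principle on the closure of `A` turns the index sum into the winding numbers of the image curves.
If `A` is unbounded, then `σ = 1` and `c = -1`; adding a large circle makes the total winding number
`1` in `A` and `0` outside its closure, and the image of that circle contributes
`-ind (f - η; ∞)`. -/

namespace HarmonicCount

open Set Complex

theorem exists_log_of_convex {E : Type*} [NormedAddCommGroup E] [NormedSpace ℝ E] {U : Set E}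
    {g : E → ℂ} (hU : IsOpen U) (hconv : Convex ℝ U) (hne : U.Nonempty) (hg : ContinuousOn g U)
    (h0 : ∀ x ∈ U, g x ≠ 0) :
    ∃ L : E → ℂ, ContinuousOn L U ∧ ∀ x ∈ U, g x = exp (L x) := by
  have : ContractibleSpace U := hconv.contractibleSpace hne
  have hsc : IsSimplyConnected U := SimplyConnectedSpace.ofContractible U
  obtain ⟨L, hL, hLg⟩ := exists_continuousOn_eqOn_exp_comp hsc hU hg
    (by rintro ⟨x, hx, hgx⟩; exact h0 x hx hgx)
  exact ⟨L, hL, fun x hx => (hLg hx).symm⟩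

section Winding

variable {g g' L : ℝ → ℂ} {a b : ℝ}

theorem exists_log_Icc (hab : a ≤ b) (hg : ContinuousOn g (Icc a b))
    (h0 : ∀ t ∈ Icc a b, g t ≠ 0) :
    ∃ L : ℝ → ℂ, ContinuousOn L (Icc a b) ∧ ∀ t ∈ Icc a b, g t = exp (L t) := by
  have hc : Continuous (IccExtend hab ((Icc a b).domRestrict g)) :=
    (continuousOn_iff_continuous_domRestrict.1 hg).Icc_extend'
  obtain ⟨L, hL, hLg⟩ := exists_log_of_convex isOpen_univ convex_univ univ_nonempty hc.continuousOn
    (fun t _ => h0 _ (projIcc a b hab t).2)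
  refine ⟨L, hL.mono (subset_univ _), fun t ht => ?_⟩
  rw [← hLg t (mem_univ t), IccExtend_of_mem _ _ ht, domRestrict_apply]

theorem IsArgumentOn.exists_int_sub_eq {θ φ : ℝ → ℝ} (hθ : IsArgumentOn g a b θ)
    (hφ : IsArgumentOn g a b φ) {t : ℝ} (ht : t ∈ Icc a b) :
    ∃ m : ℤ, (θ t - φ t) / (2 * Real.pi) = m := by
  obtain ⟨h0, h1⟩ := hθ.2 t ht
  have hn : (‖g t‖ : ℂ) ≠ 0 := by simpa using h0
  have hexp : exp (θ t * I) = exp (φ t * I) :=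
    mul_left_cancel₀ hn (h1.symm.trans (hφ.2 t ht).2)
  obtain ⟨m, hm⟩ := exp_eq_exp_iff_exists_int.1 hexp
  have him : θ t = φ t + m * (2 * Real.pi) := by simpa using congrArg Complex.im hm
  exact ⟨m, by rw [him]; field_simp; ring⟩

theorem IsArgumentOn.sub_eq_sub {θ φ : ℝ → ℝ} (hab : a ≤ b) (hθ : IsArgumentOn g a b θ)
    (hφ : IsArgumentOn g a b φ) : θ b - θ a = φ b - φ a := by
  have hc : ContinuousOn (fun t => (θ t - φ t) / (2 * Real.pi)) (Icc a b) :=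
    (hθ.1.sub hφ.1).div_const _
  have hr : MapsTo (fun t => (θ t - φ t) / (2 * Real.pi)) (Icc a b) (range ((↑) : ℤ → ℝ)) :=
    fun t ht => (hθ.exists_int_sub_eq hφ ht).imp fun _ hm => hm.symm
  have hd : IsDiscrete (range ((↑) : ℤ → ℝ)) :=
    ⟨Int.isClosedEmbedding_coe_real.isEmbedding.toHomeomorph.symm.isEmbedding.discreteTopology⟩
  have hconst := isPreconnected_Icc.constant_of_mapsTo hd hc hr (left_mem_Icc.2 hab)
    (right_mem_Icc.2 hab)
  have hpi := Real.pi_ne_zero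
  field_simp at hconst
  linarith

theorem isArgumentOn_of_exp (hL : ContinuousOn L (Icc a b))
    (hg : ∀ t ∈ Icc a b, g t = exp (L t)) : IsArgumentOn g a b (fun t => (L t).im) := by
  refine ⟨continuous_im.comp_continuousOn hL, fun t ht => ?_⟩
  rw [hg t ht]
  refine ⟨exp_ne_zero _, ?_⟩
  rw [norm_exp, ofReal_exp, ← exp_add, re_add_im]

theorem winding_eq_of_exp (hab : a ≤ b) (hL : ContinuousOn L (Icc a b))
    (hg : ∀ t ∈ Icc a b, g t = exp (L t)) :
    winding g a b = ((L b).im - (L a).im) / (2 * Real.pi) := by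
  have h : ∃ θ : ℝ → ℝ, IsArgumentOn g a b θ := ⟨_, isArgumentOn_of_exp hL hg⟩
  rw [winding, dif_pos h, IsArgumentOn.sub_eq_sub hab h.choose_spec (isArgumentOn_of_exp hL hg)]

theorem winding_congr (h : EqOn g g' (Icc a b)) : winding g a b = winding g' a b := by
  have : IsArgumentOn g a b = IsArgumentOn g' a b := by
    ext θ
    unfold IsArgumentOn
    refine and_congr_right fun _ => forall₂_congr fun t ht => ?_
    rw [h ht]
  unfold winding
  rw [this]

theorem winding_mul (hab : a ≤ b) (hg : ContinuousOn g (Icc a b)) (h0 : ∀ t ∈ Icc a b, g t ≠ 0)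
    (hg' : ContinuousOn g' (Icc a b)) (h0' : ∀ t ∈ Icc a b, g' t ≠ 0) :
    winding (fun t => g t * g' t) a b = winding g a b + winding g' a b := by
  obtain ⟨L, hL, hLg⟩ := exists_log_Icc hab hg h0
  obtain ⟨L', hL', hLg'⟩ := exists_log_Icc hab hg' h0'
  rw [winding_eq_of_exp hab hL hLg, winding_eq_of_exp hab hL' hLg',
    winding_eq_of_exp hab (hL.add hL') (fun t ht => by
      rw [hLg t ht, hLg' t ht, Pi.add_apply, exp_add])]
  simp only [Pi.add_apply, add_im]
  ring

theorem winding_div (hab : a ≤ b) (hg : ContinuousOn g (Icc a b)) (h0 : ∀ t ∈ Icc a b, g t ≠ 0)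
    (hg' : ContinuousOn g' (Icc a b)) (h0' : ∀ t ∈ Icc a b, g' t ≠ 0) :
    winding (fun t => g t / g' t) a b = winding g a b - winding g' a b := by
  have hdiv : ContinuousOn (fun t => g t / g' t) (Icc a b) := hg.div hg' h0'
  rw [eq_sub_iff_add_eq, ← winding_mul hab hdiv
    (fun t ht => div_ne_zero (h0 t ht) (h0' t ht)) hg' h0']
  exact winding_congr fun t ht => div_mul_cancel₀ _ (h0' t ht)

theorem winding_zpow (hab : a ≤ b) (hg : ContinuousOn g (Icc a b))
    (h0 : ∀ t ∈ Icc a b, g t ≠ 0) (k : ℤ) :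
    winding (fun t => g t ^ k) a b = k * winding g a b := by
  obtain ⟨L, hL, hLg⟩ := exists_log_Icc hab hg h0
  rw [winding_eq_of_exp hab hL hLg, winding_eq_of_exp (L := fun t => k * L t) hab
    (continuousOn_const.mul hL) (fun t ht => by rw [hLg t ht, exp_int_mul])]
  simp only [mul_im, intCast_re, intCast_im, zero_mul, add_zero]
  ring

theorem winding_const {w : ℂ} (hw : w ≠ 0) (hab : a ≤ b) : winding (fun _ => w) a b = 0 := by
  rw [winding_eq_of_exp (L := fun _ => log w) hab continuousOn_const
    (fun t _ => (exp_log hw).symm), sub_self, zero_div]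

theorem winding_add_adjacent {m : ℝ} (hm : m ∈ Icc a b) (hg : ContinuousOn g (Icc a b))
    (h0 : ∀ t ∈ Icc a b, g t ≠ 0) :
    winding g a b = winding g a m + winding g m b := by
  obtain ⟨L, hL, hLg⟩ := exists_log_Icc (hm.1.trans hm.2) hg h0
  have h1 : Icc a m ⊆ Icc a b := Icc_subset_Icc_right hm.2
  have h2 : Icc m b ⊆ Icc a b := Icc_subset_Icc_left hm.1
  rw [winding_eq_of_exp (hm.1.trans hm.2) hL hLg,
    winding_eq_of_exp hm.1 (hL.mono h1) (fun t ht => hLg t (h1 ht)),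
    winding_eq_of_exp hm.2 (hL.mono h2) (fun t ht => hLg t (h2 ht))]
  ring

theorem winding_comp_const_sub {s : ℝ} (hab : a ≤ b) (hg : ContinuousOn g (Icc (s - b) (s - a)))
    (h0 : ∀ t ∈ Icc (s - b) (s - a), g t ≠ 0) :
    winding (fun t => g (s - t)) a b = -winding g (s - b) (s - a) := by
  have hle : s - b ≤ s - a := by linarith
  obtain ⟨L, hL, hLg⟩ := exists_log_Icc hle hg h0
  have hm : MapsTo (fun t => s - t) (Icc a b) (Icc (s - b) (s - a)) :=
    fun t ht => ⟨by linarith [ht.2], by linarith [ht.1]⟩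
  rw [winding_eq_of_exp hle hL hLg,
    winding_eq_of_exp hab (hL.comp (by fun_prop) hm) (fun t ht => hLg _ (hm ht))]
  simp only [Function.comp_apply]
  ring

theorem winding_eq_of_slitPlane (hab : a ≤ b) (hg : ContinuousOn g (Icc a b))
    (hs : ∀ t ∈ Icc a b, g t ∈ slitPlane) :
    winding g a b = (arg (g b) - arg (g a)) / (2 * Real.pi) := by
  rw [winding_eq_of_exp (L := fun t => log (g t)) hab (hg.clog hs)
    (fun t ht => (exp_log (slitPlane_ne_zero (hs t ht))).symm), log_im, log_im]

theorem mem_slitPlane_of_norm_sub_one_lt {z : ℂ} (hz : ‖z - 1‖ < 1) : z ∈ slitPlane := by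
  simpa using mem_slitPlane_of_norm_lt_one hz

theorem abs_winding_le_of_norm_sub_one_le {ε : ℝ} (hε : ε ≤ 1 / 2) (hab : a ≤ b)
    (hg : ContinuousOn g (Icc a b)) (hs : ∀ t ∈ Icc a b, ‖g t - 1‖ ≤ ε) :
    |winding g a b| ≤ ε / 2 := by
  have harg : ∀ t ∈ Icc a b, |arg (g t)| ≤ 3 / 2 * ε := fun t ht => by
    have hlog := norm_log_one_add_half_le_self ((hs t ht).trans hε)
    rw [add_sub_cancel] at hlog
    rw [← log_im]
    linarith [abs_im_le_norm (log (g t)), hs t ht]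
  have hε0 : 0 ≤ ε := (norm_nonneg _).trans (hs a (left_mem_Icc.2 hab))
  have htri := abs_sub (arg (g b)) (arg (g a))
  have ha := harg a (left_mem_Icc.2 hab)
  have hb := harg b (right_mem_Icc.2 hab)
  rw [winding_eq_of_slitPlane hab hg fun t ht =>
      mem_slitPlane_of_norm_sub_one_lt ((hs t ht).trans_lt (by linarith)),
    abs_div, abs_of_pos Real.two_pi_pos, div_le_iff₀ Real.two_pi_pos]
  nlinarith [Real.pi_gt_three]

end Winding

/-- `c : [a, b] → ℂ` is a closed curve. -/
structure IsClosedCurve (c : ℝ → ℂ) (a b : ℝ) : Prop where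
  le : a ≤ b
  continuousOn : ContinuousOn c (Icc a b)
  closed : c a = c b

namespace IsClosedCurve

variable {c c' : ℝ → ℂ} {a b : ℝ} {p z : ℂ}

protected theorem comp {g : ℂ → ℂ} {s : Set ℂ} (hc : IsClosedCurve c a b)
    (hg : ContinuousOn g s) (hcs : MapsTo c (Icc a b) s) :
    IsClosedCurve (fun t => g (c t)) a b :=
  ⟨hc.le, hg.comp hc.continuousOn hcs, by rw [hc.closed]⟩

theorem sub_const (hc : IsClosedCurve c a b) (p : ℂ) : IsClosedCurve (fun t => c t - p) a b :=
  hc.comp (g := fun w => w - p) (by fun_prop) (mapsTo_univ _ _)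

theorem exists_int_winding_eq (hc : IsClosedCurve c a b) (h0 : ∀ t ∈ Icc a b, c t ≠ 0) :
    ∃ m : ℤ, winding c a b = m := by
  obtain ⟨L, hL, hLc⟩ := exists_log_Icc hc.le hc.continuousOn h0
  have hexp : exp (L b) = exp (L a) := by
    rw [← hLc a (left_mem_Icc.2 hc.le), ← hLc b (right_mem_Icc.2 hc.le), hc.closed]
  obtain ⟨m, hm⟩ := exp_eq_exp_iff_exists_int.1 hexp
  have him : (L b).im = (L a).im + m * (2 * Real.pi) := by simpa using congrArg Complex.im hm
  refine ⟨m, ?_⟩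
  rw [winding_eq_of_exp hc.le hL hLc, him]
  field_simp
  ring

theorem winding_exp (hc : IsClosedCurve c a b) : winding (fun t => exp (c t)) a b = 0 := by
  rw [winding_eq_of_exp hc.le hc.continuousOn (fun _ _ => rfl), hc.closed, sub_self, zero_div]

theorem winding_eq_of_norm_sub_lt (hc : IsClosedCurve c a b) (hc' : IsClosedCurve c' a b)
    (h : ∀ t ∈ Icc a b, ‖c' t - c t‖ < ‖c t‖) : winding c' a b = winding c a b := by
  have h0 : ∀ t ∈ Icc a b, c t ≠ 0 := fun t ht h1 =>
    (norm_nonneg _).not_gt (by simpa [h1] using h t ht)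
  have h0' : ∀ t ∈ Icc a b, c' t ≠ 0 := fun t ht h1 => by simpa [h1] using h t ht
  have hslit : ∀ t ∈ Icc a b, c' t / c t ∈ slitPlane := fun t ht => by
    apply mem_slitPlane_of_norm_sub_one_lt
    rw [div_sub_one (h0 t ht), norm_div, div_lt_one (norm_pos_iff.2 (h0 t ht))]
    exact h t ht
  have hdiv : ContinuousOn (fun t => c' t / c t) (Icc a b) :=
    hc'.continuousOn.div hc.continuousOn h0
  rw [← sub_eq_zero, ← winding_div hc.le hc'.continuousOn h0' hc.continuousOn h0,
    winding_eq_of_slitPlane hc.le hdiv hslit,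
    hc.closed, hc'.closed, sub_self, zero_div]

end IsClosedCurve

section WindingNumber

variable {c : ℝ → ℂ} {a b : ℝ} {p z : ℂ}

theorem exists_pos_forall_le_norm_sub (hc : ContinuousOn c (Icc a b)) (hp : p ∉ c '' Icc a b) :
    ∃ r > 0, ∀ t ∈ Icc a b, r ≤ ‖c t - p‖ :=
  isCompact_Icc.exists_forall_le' (hc.sub continuousOn_const).norm
    fun t ht => norm_pos_iff.2 (sub_ne_zero.2 fun h => hp ⟨t, ht, h⟩)

theorem IsClosedCurve.eventually_windingNumber_eq (hc : IsClosedCurve c a b)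
    (hp : p ∉ c '' Icc a b) : ∀ᶠ q in 𝓝 p, windingNumber c a b q = windingNumber c a b p := by
  obtain ⟨r, hr, hle⟩ := exists_pos_forall_le_norm_sub hc.continuousOn hp
  filter_upwards [Metric.ball_mem_nhds p hr] with q hq
  refine (hc.sub_const p).winding_eq_of_norm_sub_lt (hc.sub_const q) fun t ht => ?_
  rw [sub_sub_sub_cancel_left, norm_sub_rev]
  exact (mem_ball_iff_norm.1 hq).trans_le (hle t ht)

theorem IsClosedCurve.windingNumber_eq_zero (hc : IsClosedCurve c a b)
    (hp : ∀ t ∈ Icc a b, ‖c t - z‖ < ‖p - z‖) : windingNumber c a b p = 0 := by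
  have hzp : z - p ≠ 0 := by
    rw [← norm_pos_iff, norm_sub_rev]
    exact (norm_nonneg _).trans_lt (hp a (left_mem_Icc.2 hc.le))
  rw [← winding_const hzp hc.le]
  refine IsClosedCurve.winding_eq_of_norm_sub_lt ⟨hc.le, continuousOn_const, rfl⟩
    (hc.sub_const p) fun t ht => ?_
  rw [sub_sub_sub_cancel_right, norm_sub_rev z p]
  exact hp t ht

theorem IsClosedCurve.eventually_windingNumber_eq_zero (hc : IsClosedCurve c a b) :
    ∀ᶠ q in Bornology.cobounded ℂ, windingNumber c a b q = 0 := by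
  obtain ⟨M, hM⟩ := (isCompact_Icc.image_of_continuousOn hc.continuousOn).isBounded.exists_norm_le
  filter_upwards [tendsto_norm_cobounded_atTop.eventually_gt_atTop M] with q hq
  refine hc.windingNumber_eq_zero (z := 0) fun t ht => ?_
  rw [sub_zero, sub_zero]
  exact (hM _ (mem_image_of_mem c ht)).trans_lt hq

theorem continuousAt_winding_sub (hab : a ≤ b) (hc : ContinuousOn c (Icc a b))
    (hp : p ∉ c '' Icc a b) : ContinuousAt (fun q => winding (fun t => c t - q) a b) p := by
  obtain ⟨r, hr, hle⟩ := exists_pos_forall_le_norm_sub hc hp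
  refine Metric.continuousAt_iff'.2 fun ε hε => ?_
  have hδ : 0 < min ε (1 / 2) := lt_min hε (by norm_num)
  filter_upwards [Metric.ball_mem_nhds p (mul_pos hδ hr)] with q hq
  have h0 : ∀ t ∈ Icc a b, c t - p ≠ 0 := fun t ht => norm_pos_iff.1 (hr.trans_le (hle t ht))
  have hnear : ∀ t ∈ Icc a b, ‖(c t - q) / (c t - p) - 1‖ ≤ min ε (1 / 2) := fun t ht => by
    rw [div_sub_one (h0 t ht), norm_div, div_le_iff₀ (norm_pos_iff.2 (h0 t ht)),
      sub_sub_sub_cancel_left, norm_sub_rev]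
    exact (mem_ball_iff_norm.1 hq).le.trans (mul_le_mul_of_nonneg_left (hle t ht) hδ.le)
  have h0' : ∀ t ∈ Icc a b, c t - q ≠ 0 := fun t ht h => by
    have := hnear t ht
    simp only [h, zero_div, zero_sub, norm_neg, norm_one] at this
    linarith [min_le_right ε (1 / 2)]
  have hcp : ContinuousOn (fun t => c t - p) (Icc a b) := hc.sub continuousOn_const
  have hcq : ContinuousOn (fun t => c t - q) (Icc a b) := hc.sub continuousOn_const
  rw [Real.dist_eq, ← winding_div hab hcq h0' hcp h0]
  refine (abs_winding_le_of_norm_sub_one_le (min_le_right _ _) hab (hcq.div hcp h0)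
    hnear).trans_lt ?_
  linarith [min_le_left ε (1 / 2)]

end WindingNumber

section Circle

variable {z p : ℂ} {R : ℝ}

theorem isClosedCurve_circleMap (z : ℂ) (R s : ℝ) :
    IsClosedCurve (circleMap z R) s (s + 2 * Real.pi) :=
  ⟨by linarith [Real.pi_pos], (continuous_circleMap z R).continuousOn,
    (periodic_circleMap z R s).symm⟩

theorem windingNumber_circleMap_center (z : ℂ) (hR : 0 < R) (s : ℝ) :
    windingNumber (circleMap z R) s (s + 2 * Real.pi) z = 1 := by
  rw [windingNumber, winding_eq_of_exp (L := fun t : ℝ => (Real.log R : ℂ) + t * I)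
    (isClosedCurve_circleMap z R s).le (by fun_prop) (fun t _ => ?_)]
  · simp [Real.pi_ne_zero]
  · rw [exp_add, ← ofReal_exp, Real.exp_log hR, circleMap_sub_center, circleMap_zero]

theorem windingNumber_circleMap_of_lt (h : ‖p - z‖ < R) (s : ℝ) :
    windingNumber (circleMap z R) s (s + 2 * Real.pi) p = 1 := by
  have hR : 0 < R := (norm_nonneg _).trans_lt h
  have hc := isClosedCurve_circleMap z R s
  rw [← windingNumber_circleMap_center z hR s]
  refine (hc.sub_const z).winding_eq_of_norm_sub_lt (hc.sub_const p) fun t _ => ?_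
  rwa [sub_sub_sub_cancel_left, norm_sub_rev, circleMap_sub_center, norm_circleMap_zero,
    abs_of_pos hR]

theorem windingNumber_circleMap_of_gt (hR : 0 ≤ R) (h : R < ‖p - z‖) (s : ℝ) :
    windingNumber (circleMap z R) s (s + 2 * Real.pi) p = 0 :=
  (isClosedCurve_circleMap z R s).windingNumber_eq_zero fun t _ => by
    rwa [circleMap_sub_center, norm_circleMap_zero, abs_of_nonneg hR]

end Circle

section Index

variable {g g' m : ℂ → ℂ} {z : ℂ} {k l : ℤ}

/-- `g` has index `k` at `z`: near `z` it is `(w - z) ^ k` times a function with a continuous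
logarithm. Asking for the logarithm on all of `ℂ ∖ {z}` is no restriction, as a logarithm near
`z` extends radially. -/
def HasIndexAt (g : ℂ → ℂ) (z : ℂ) (k : ℤ) : Prop :=
  ∃ L : ℂ → ℂ, ContinuousOn L {z}ᶜ ∧ ∀ᶠ w in 𝓝[≠] z, g w = (w - z) ^ k * exp (L w)

theorem eventually_punctured_iff {p : ℂ → Prop} :
    (∀ᶠ w in 𝓝[≠] z, p w) ↔ ∃ r > 0, ∀ w ∈ Metric.ball z r \ {z}, p w := by
  rw [(nhdsWithin_hasBasis Metric.nhds_basis_ball {z}ᶜ).eventually_iff]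
  rfl

theorem exists_continuousOn_compl_singleton {L : ℂ → ℂ} (hL : ∀ᶠ w in 𝓝[≠] z, ContinuousAt L w) :
    ∃ L' : ℂ → ℂ, ContinuousOn L' {z}ᶜ ∧ L' =ᶠ[𝓝[≠] z] L := by
  obtain ⟨r, hr, hL⟩ := eventually_punctured_iff.1 hL
  have hs : 0 < r / 2 := half_pos hr
  set π : ℂ → ℂ := fun w => z + ((min 1 (r / 2 / ‖w - z‖) : ℝ) : ℂ) * (w - z)
  have hπ : ∀ w ≠ z, π w ∈ Metric.ball z r \ {z} := fun w hw => by
    have hpos : 0 < ‖w - z‖ := norm_pos_iff.2 (sub_ne_zero.2 hw)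
    have hmin : 0 < min 1 (r / 2 / ‖w - z‖) := lt_min one_pos (div_pos hs hpos)
    refine ⟨?_, fun h => ?_⟩
    · rw [mem_ball_iff_norm, add_sub_cancel_left, norm_mul, norm_real, Real.norm_of_nonneg hmin.le]
      have hle := mul_le_mul_of_nonneg_right (min_le_right 1 (r / 2 / ‖w - z‖)) hpos.le
      rw [div_mul_cancel₀ _ hpos.ne'] at hle
      linarith
    · rw [mem_singleton_iff, add_eq_left] at h
      exact mul_ne_zero (ofReal_ne_zero.2 hmin.ne') (sub_ne_zero.2 hw) h
  have hπc : ContinuousOn π {z}ᶜ := by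
    have hnorm : ContinuousOn (fun w => r / 2 / ‖w - z‖) {z}ᶜ :=
      continuousOn_const.div (by fun_prop) fun w hw => norm_ne_zero_iff.2 (sub_ne_zero.2 hw)
    fun_prop
  have hLπ : ContinuousOn L (Metric.ball z r \ {z}) :=
    fun w hw => (hL w hw).continuousWithinAt
  refine ⟨L ∘ π, hLπ.comp hπc hπ, ?_⟩
  filter_upwards [eventually_punctured_iff.2 ⟨r / 2, hs, fun w hw => hw⟩] with w hw
  have hle : 1 ≤ r / 2 / ‖w - z‖ :=
    (one_le_div (norm_pos_iff.2 (sub_ne_zero.2 hw.2))).2 (mem_ball_iff_norm.1 hw.1).le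
  simp only [π, Function.comp_apply, min_eq_left hle, ofReal_one, one_mul, add_sub_cancel]

namespace HasIndexAt

theorem congr (h : HasIndexAt g z k) (hgg' : g =ᶠ[𝓝[≠] z] g') : HasIndexAt g' z k := by
  obtain ⟨L, hL, hg⟩ := h
  exact ⟨L, hL, by filter_upwards [hg, hgg'] with w hw hw' using hw' ▸ hw⟩

theorem mul (h : HasIndexAt g z k) (h' : HasIndexAt g' z l) :
    HasIndexAt (fun w => g w * g' w) z (k + l) := by
  obtain ⟨L, hL, hg⟩ := h
  obtain ⟨L', hL', hg'⟩ := h'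
  refine ⟨fun w => L w + L' w, hL.add hL', ?_⟩
  filter_upwards [hg, hg', self_mem_nhdsWithin] with w hw hw' hwz
  rw [hw, hw', exp_add, zpow_add₀ (sub_ne_zero.2 hwz)]
  ring

theorem conj (h : HasIndexAt g z k) : HasIndexAt (fun w => (starRingEnd ℂ) (g w)) z (-k) := by
  obtain ⟨L, hL, hg⟩ := h
  have hlog : ContinuousOn (fun w => Real.log ‖w - z‖) {z}ᶜ :=
    ContinuousOn.log (by fun_prop) fun w hw => norm_ne_zero_iff.2 (sub_ne_zero.2 hw)
  refine ⟨fun w => k * ((2 * Real.log ‖w - z‖ : ℝ) : ℂ) + (starRingEnd ℂ) (L w), ?_, ?_⟩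
  · exact (continuousOn_const.mul (continuous_ofReal.comp_continuousOn
      (continuousOn_const.mul hlog))).add (continuous_conj.comp_continuousOn hL)
  filter_upwards [hg, self_mem_nhdsWithin] with w hw hwz
  have hwz : w - z ≠ 0 := sub_ne_zero.2 hwz
  have hexp : exp ((2 * Real.log ‖w - z‖ : ℝ) : ℂ) = (w - z) * (starRingEnd ℂ) (w - z) := by
    rw [mul_conj, ← ofReal_exp, two_mul, Real.exp_add, Real.exp_log (norm_pos_iff.2 hwz),
      normSq_eq_norm_sq, sq]
  rw [hw, map_mul, map_zpow₀, ← exp_conj, exp_add, exp_int_mul, hexp, mul_zpow, zpow_neg, mul_assoc,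
    inv_mul_cancel_left₀ (zpow_ne_zero _ hwz)]

theorem eventually_ne_zero (h : HasIndexAt g z k) : ∀ᶠ w in 𝓝[≠] z, g w ≠ 0 := by
  obtain ⟨L, -, hg⟩ := h
  filter_upwards [hg, self_mem_nhdsWithin] with w hw hwz
  rw [hw]
  exact mul_ne_zero (zpow_ne_zero _ (sub_ne_zero.2 hwz)) (exp_ne_zero _)

end HasIndexAt

theorem continuousOn_zpow_mul_exp {L : ℂ → ℂ} (hL : ContinuousOn L {z}ᶜ) :
    ContinuousOn (fun w => (w - z) ^ k * exp (L w)) {z}ᶜ :=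
  ((by fun_prop : ContinuousOn (fun w => w - z) {z}ᶜ).zpow₀ k
    fun _ hw => Or.inl (sub_ne_zero.2 hw)).mul hL.cexp

theorem HasIndexAt.eventually_continuousAt (h : HasIndexAt g z k) :
    ∀ᶠ w in 𝓝[≠] z, ContinuousAt g w := by
  obtain ⟨L, hL, hg⟩ := h
  filter_upwards [eventually_eventually_nhdsWithin.2 hg, self_mem_nhdsWithin] with w hw hwz
  rw [isOpen_compl_singleton.nhdsWithin_eq hwz] at hw
  exact ((continuousOn_zpow_mul_exp hL).continuousAt (isOpen_compl_singleton.mem_nhds hwz)).congr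
    (hw.mono fun v hv => hv.symm)

theorem hasIndexAt_zero_of_slitPlane
    (h : ∀ᶠ w in 𝓝[≠] z, ContinuousAt g w ∧ g w ∈ slitPlane) : HasIndexAt g z 0 := by
  obtain ⟨L, hL, hLg⟩ := exists_continuousOn_compl_singleton (L := fun w => log (g w))
    (h.mono fun w hw => hw.1.clog hw.2)
  refine ⟨L, hL, ?_⟩
  filter_upwards [h, hLg] with w hw hwL
  rw [hwL, exp_log (slitPlane_ne_zero hw.2), zpow_zero, one_mul]

theorem hasIndexAt_zpow (z : ℂ) (k : ℤ) : HasIndexAt (fun w => (w - z) ^ k) z k :=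
  ⟨fun _ => 0, continuousOn_const, .of_forall fun w => by rw [exp_zero, mul_one]⟩

theorem hasIndexAt_const {c : ℂ} (hc : c ≠ 0) (z : ℂ) : HasIndexAt (fun _ => c) z 0 :=
  ⟨fun _ => log c, continuousOn_const, .of_forall fun w => by rw [exp_log hc, zpow_zero, one_mul]⟩

theorem HasIndexAt.of_norm_sub_lt (hm : HasIndexAt m z k) (hg : ∀ᶠ w in 𝓝[≠] z, ContinuousAt g w)
    (h : ∀ᶠ w in 𝓝[≠] z, ‖g w - m w‖ < ‖m w‖) : HasIndexAt g z k := by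
  have hquot : HasIndexAt (fun w => g w / m w) z 0 := by
    apply hasIndexAt_zero_of_slitPlane
    filter_upwards [hm.eventually_ne_zero, hm.eventually_continuousAt, hg, h] with w h0 hmc hgc hlt
    refine ⟨hgc.div hmc h0, mem_slitPlane_of_norm_sub_one_lt ?_⟩
    rwa [div_sub_one h0, norm_div, div_lt_one (norm_pos_iff.2 h0)]
  rw [← add_zero k]
  refine (hm.mul hquot).congr ?_
  filter_upwards [hm.eventually_ne_zero] with w h0
  exact mul_div_cancel₀ _ h0

theorem hasIndexAt_zero_of_continuousAt (h0 : g z ≠ 0) (hg : ∀ᶠ w in 𝓝 z, ContinuousAt g w) :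
    HasIndexAt g z 0 := by
  refine (hasIndexAt_const h0 z).of_norm_sub_lt (hg.filter_mono nhdsWithin_le_nhds) ?_
  have hlim : Tendsto (fun w => ‖g w - g z‖) (𝓝 z) (𝓝 0) :=
    tendsto_iff_norm_sub_tendsto_zero.1 hg.self_of_nhds
  exact (hlim.eventually_lt_const (norm_pos_iff.2 h0)).filter_mono nhdsWithin_le_nhds

theorem IsClosedCurve.winding_zpow_mul_exp {c : ℝ → ℂ} {a b : ℝ} (hc : IsClosedCurve c a b)
    (hcz : MapsTo c (Icc a b) {z}ᶜ) {L : ℂ → ℂ} (hL : ContinuousOn L {z}ᶜ) :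
    winding (fun t => (c t - z) ^ k * exp (L (c t))) a b = k * windingNumber c a b z := by
  have hLc := hc.comp hL hcz
  have h0 : ∀ t ∈ Icc a b, c t - z ≠ 0 := fun t ht => sub_ne_zero.2 (hcz ht)
  have hcc := (hc.sub_const z).continuousOn
  rw [winding_mul hc.le (hcc.zpow₀ k fun t ht => Or.inl (h0 t ht))
      (fun t ht => zpow_ne_zero _ (h0 t ht)) hLc.continuousOn.cexp (fun _ _ => exp_ne_zero _),
    winding_zpow hc.le hcc h0, hLc.winding_exp, add_zero, windingNumber]

theorem HasIndexAt.poincareIndex_eq (h : HasIndexAt g z k) : poincareIndex g z = k := by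
  obtain ⟨L, hL, hg⟩ := h
  obtain ⟨r, hr, hg⟩ := eventually_punctured_iff.1 hg
  refine (tendsto_const_nhds.congr' ?_).limUnder_eq
  filter_upwards [Ioo_mem_nhdsGT hr] with ρ hρ
  have hmem : ∀ t, circleMap z ρ t ∈ Metric.ball z r \ {z} := fun t =>
    ⟨by rw [mem_ball_iff_norm, circleMap_sub_center, norm_circleMap_zero, abs_of_pos hρ.1]
        exact hρ.2,
      circleMap_ne_center hρ.1.ne'⟩
  have hwind := (isClosedCurve_circleMap z ρ 0).winding_zpow_mul_exp (k := k)
    (fun t _ => (hmem t).2) hL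
  rw [windingNumber_circleMap_center z hρ.1, mul_one, zero_add] at hwind
  rw [← hwind]
  exact winding_congr fun t _ => (hg _ (hmem t)).symm

end Index

/-- `a` and `b` are the Wirtinger derivatives `∂f/∂z` and `∂f/∂z̄` of the real-differentiable
function `f` at `z`, i.e. the real differential of `f` at `z` is `v ↦ a v + b v̄`. -/
def HasWirtingerDerivAt (f : ℂ → ℂ) (a b z : ℂ) : Prop :=
  HasFDerivAt f (a • ContinuousLinearMap.id ℝ ℂ + b • (conjCLE : ℂ →L[ℝ] ℂ)) z

section Wirtinger

variable {f g : ℂ → ℂ} {a b a' b' z z₀ : ℂ}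

theorem hasWirtingerDerivAt_of_hasFDerivAt {D : ℂ →L[ℝ] ℂ} (hD : HasFDerivAt f D z)
    (h : ∀ v, D v = a * v + b * (starRingEnd ℂ) v) : HasWirtingerDerivAt f a b z :=
  hD.congr_fderiv (ContinuousLinearMap.ext h)

theorem hasWirtingerDerivAt_of_differentiableAt (hf : DifferentiableAt ℝ f z) :
    HasWirtingerDerivAt f (dz f z) (dzbar f z) z := by
  refine hasWirtingerDerivAt_of_hasFDerivAt hf.hasFDerivAt fun v => ?_
  have hv : v = v.re • (1 : ℂ) + v.im • I := by simp
  conv_lhs => rw [hv, map_add, map_smul, map_smul]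
  conv_rhs => rw [dz, dzbar, ← re_add_im v]
  simp only [map_add, map_mul, conj_ofReal, conj_I, real_smul]
  linear_combination ((v.im : ℂ) * fderiv ℝ f z I) * I_mul_I

namespace HasWirtingerDerivAt

theorem differentiableAt (h : HasWirtingerDerivAt f a b z) : DifferentiableAt ℝ f z :=
  HasFDerivAt.differentiableAt h

theorem fderiv_apply (h : HasWirtingerDerivAt f a b z) (v : ℂ) :
    fderiv ℝ f z v = a * v + b * (starRingEnd ℂ) v := by
  rw [HasFDerivAt.fderiv h]
  rfl

theorem dz_eq (h : HasWirtingerDerivAt f a b z) : dz f z = a := by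
  rw [dz, h.fderiv_apply, h.fderiv_apply, map_one, conj_I]
  linear_combination (-a / 2 + b / 2) * I_mul_I

theorem dzbar_eq (h : HasWirtingerDerivAt f a b z) : dzbar f z = b := by
  rw [dzbar, h.fderiv_apply, h.fderiv_apply, map_one, conj_I]
  linear_combination (a / 2 - b / 2) * I_mul_I

theorem jacobian_eq (h : HasWirtingerDerivAt f a b z) : jacobian f z = ‖a‖ ^ 2 - ‖b‖ ^ 2 := by
  rw [jacobian, h.dz_eq, h.dzbar_eq]

theorem congr_of_eventuallyEq (h : HasWirtingerDerivAt f a b z) (hg : g =ᶠ[𝓝 z] f) :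
    HasWirtingerDerivAt g a b z :=
  HasFDerivAt.congr_of_eventuallyEq h hg

theorem add (h : HasWirtingerDerivAt f a b z) (h' : HasWirtingerDerivAt g a' b' z) :
    HasWirtingerDerivAt (fun w => f w + g w) (a + a') (b + b') z :=
  hasWirtingerDerivAt_of_hasFDerivAt (HasFDerivAt.add h h') fun v => by
    simp only [add_apply, smul_apply, smul_eq_mul,
      ContinuousLinearMap.id_apply, ContinuousLinearEquiv.coe_coe, conjCLE_apply]
    ring

theorem const_mul (h : HasWirtingerDerivAt f a b z) (c : ℂ) :
    HasWirtingerDerivAt (fun w => c * f w) (c * a) (c * b) z :=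
  hasWirtingerDerivAt_of_hasFDerivAt (HasFDerivAt.const_mul h c) fun v => by
    simp only [add_apply, smul_apply, smul_eq_mul,
      ContinuousLinearMap.id_apply, ContinuousLinearEquiv.coe_coe, conjCLE_apply]
    ring

theorem conj (h : HasWirtingerDerivAt f a b z) :
    HasWirtingerDerivAt (fun w => (starRingEnd ℂ) (f w)) ((starRingEnd ℂ) b)
      ((starRingEnd ℂ) a) z :=
  hasWirtingerDerivAt_of_hasFDerivAt (conjCLE.hasFDerivAt.comp z h) fun v => by
    simp [add_comm]

end HasWirtingerDerivAt

theorem hasWirtingerDerivAt_of_hasDerivAt (h : HasDerivAt f a z) :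
    HasWirtingerDerivAt f a 0 z :=
  hasWirtingerDerivAt_of_hasFDerivAt (h.hasFDerivAt.restrictScalars ℝ) fun v => by
    simp [mul_comm]

theorem hasWirtingerDerivAt_log_norm_sub (h : z ≠ z₀) :
    HasWirtingerDerivAt (fun w => (Real.log ‖w - z₀‖ : ℂ)) (1 / (2 * (z - z₀)))
      ((starRingEnd ℂ) (1 / (2 * (z - z₀)))) z := by
  have h0 : z - z₀ ≠ 0 := sub_ne_zero.2 h
  have hsq : HasFDerivAt (fun w : ℂ => ‖w - z₀‖ ^ 2) _ z :=
    ((hasFDerivAt_id (𝕜 := ℝ) z).sub_const z₀).norm_sq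
  have hlog := ofRealCLM.hasFDerivAt.comp z ((hsq.log (by positivity)).const_mul (1 / 2 : ℝ))
  refine hasWirtingerDerivAt_of_hasFDerivAt
    (hlog.congr_of_eventuallyEq (.of_forall fun w => by simp)) fun v => ?_
  have hconj : (starRingEnd ℂ) (z - z₀) ≠ 0 := (map_ne_zero _).2 h0
  have hnorm : ((‖z - z₀‖ : ℂ)) ^ 2 = (z - z₀) * (starRingEnd ℂ) (z - z₀) := by
    rw [mul_conj, normSq_eq_norm_sq, ofReal_pow]
  have hinner : ((inner ℝ (z - z₀) v : ℝ) : ℂ) =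
      ((starRingEnd ℂ) (z - z₀) * v + (z - z₀) * (starRingEnd ℂ) v) / 2 := by
    rw [Complex.inner, re_eq_add_conj]
    simp [mul_comm]
  change ((1 / 2 * ((‖z - z₀‖ ^ 2)⁻¹ * (2 • inner ℝ (z - z₀) v)) : ℝ) : ℂ) = _
  rw [nsmul_eq_mul, map_div₀, map_mul, map_one, map_ofNat]
  push_cast
  rw [hinner, hnorm]
  field_simp

theorem det_fderiv_eq_jacobian (f : ℂ → ℂ) (z : ℂ) : (fderiv ℝ f z).det = jacobian f z := by
  have hdet : (fderiv ℝ f z).det =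
      (fderiv ℝ f z 1).re * (fderiv ℝ f z I).im - (fderiv ℝ f z I).re * (fderiv ℝ f z 1).im := by
    rw [ContinuousLinearMap.det, ← LinearMap.det_toMatrix basisOneI, Matrix.det_fin_two]
    simp [LinearMap.toMatrix_apply]
  rw [hdet, jacobian, dz, dzbar, ← normSq_eq_norm_sq, ← normSq_eq_norm_sq]
  simp only [map_div₀, normSq_apply, sub_re, mul_re, I_re, zero_mul, I_im, one_mul, zero_sub,
    sub_neg_eq_add, sub_im, mul_im, zero_add, add_re, add_im, re_ofNat, im_ofNat]
  ring

theorem jacobian_sub_const (f : ℂ → ℂ) (c z : ℂ) :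
    jacobian (fun w => f w - c) z = jacobian f z := by
  simp only [jacobian, dz, dzbar, fderiv_sub_const]

theorem jacobian_conj (hf : DifferentiableAt ℝ f z) :
    jacobian (fun w => (starRingEnd ℂ) (f w)) z = -jacobian f z := by
  have h := hasWirtingerDerivAt_of_differentiableAt hf
  rw [h.conj.jacobian_eq, h.jacobian_eq, norm_conj, norm_conj, neg_sub]

theorem hasIndexAt_one_of_jacobian_pos (hz : f z = 0) (hd : DifferentiableAt ℝ f z)
    (hc : ∀ᶠ w in 𝓝 z, ContinuousAt f w) (hJ : 0 < jacobian f z) : HasIndexAt f z 1 := by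
  have hlt : ‖dzbar f z‖ < ‖dz f z‖ :=
    lt_of_pow_lt_pow_left₀ 2 (norm_nonneg _) (sub_pos.1 hJ)
  have hlin : HasIndexAt (fun w => dz f z * (w - z)) z 1 := by
    simpa using (hasIndexAt_const (norm_pos_iff.1 ((norm_nonneg _).trans_lt hlt)) z).mul
      (hasIndexAt_zpow z 1)
  refine hlin.of_norm_sub_lt (hc.filter_mono nhdsWithin_le_nhds) ?_
  have hε : 0 < (‖dz f z‖ - ‖dzbar f z‖) / 2 := by linarith
  have happrox := (hasFDerivAt_iff_isLittleO.1 hd.hasFDerivAt).def hε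
  filter_upwards [happrox.filter_mono nhdsWithin_le_nhds, self_mem_nhdsWithin] with w hw hne
  have hpos : 0 < ‖w - z‖ := norm_pos_iff.2 (sub_ne_zero.2 hne)
  rw [(hasWirtingerDerivAt_of_differentiableAt hd).fderiv_apply, hz, sub_zero] at hw
  calc ‖f w - dz f z * (w - z)‖
      = ‖(f w - (dz f z * (w - z) + dzbar f z * (starRingEnd ℂ) (w - z))) +
          dzbar f z * (starRingEnd ℂ) (w - z)‖ := by congr 1; ring
    _ ≤ (‖dz f z‖ - ‖dzbar f z‖) / 2 * ‖w - z‖ + ‖dzbar f z‖ * ‖w - z‖ := by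
        refine (norm_add_le _ _).trans (add_le_add hw ?_)
        rw [norm_mul, norm_conj]
    _ < ‖dz f z‖ * ‖w - z‖ := by nlinarith
    _ = ‖dz f z * (w - z)‖ := (norm_mul _ _).symm

theorem hasIndexAt_neg_one_of_jacobian_neg (hz : f z = 0) (hd : DifferentiableAt ℝ f z)
    (hc : ∀ᶠ w in 𝓝 z, ContinuousAt f w) (hJ : jacobian f z < 0) : HasIndexAt f z (-1) := by
  have hconj := hasIndexAt_one_of_jacobian_pos (f := fun w => (starRingEnd ℂ) (f w))
    (by rw [hz, map_zero]) (conjCLE.differentiableAt.comp z hd)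
    (hc.mono fun w hw => continuous_conj.continuousAt.comp hw)
    (by rw [jacobian_conj hd]; exact neg_pos.2 hJ)
  simpa only [conj_conj] using hconj.conj

theorem hasIndexAt_of_jacobian {σ : ℤˣ} (hz : f z = 0) (hd : DifferentiableAt ℝ f z)
    (hc : ∀ᶠ w in 𝓝 z, ContinuousAt f w) (hJ : 0 < ((σ : ℤ) : ℝ) * jacobian f z) :
    HasIndexAt f z σ := by
  rcases Int.units_eq_one_or σ with rfl | rfl
  · exact hasIndexAt_one_of_jacobian_pos hz hd hc (by simpa using hJ)
  · exact hasIndexAt_neg_one_of_jacobian_neg hz hd hc (by simpa using hJ)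

theorem exists_regular_value_norm_lt {δ : ℝ} (hf : Differentiable ℝ f) (hδ : 0 < δ) :
    ∃ ε : ℂ, ‖ε‖ < δ ∧ ∀ z, f z = ε → jacobian f z ≠ 0 := by
  have hnull : MeasureTheory.volume (f '' {z | jacobian f z = 0}) = 0 :=
    MeasureTheory.addHaar_image_eq_zero_of_det_fderivWithin_eq_zero _
      (fun z _ => (hf z).hasFDerivAt.hasFDerivWithinAt)
      (fun z hz => by rw [det_fderiv_eq_jacobian]; exact hz)
  have hball := Metric.measure_ball_pos MeasureTheory.volume (0 : ℂ) hδ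
  obtain ⟨ε, hε, hcrit⟩ := not_subset.1 fun hsub =>
    hball.not_ge ((MeasureTheory.measure_mono hsub).trans hnull.le)
  exact ⟨ε, mem_ball_zero_iff.1 hε, fun z hz hJ => hcrit ⟨z, hJ, hz⟩⟩

end Wirtinger

theorem finite_of_eventually_notMem {X : Type*} [TopologicalSpace X] {s K : Set X}
    (hK : IsCompact K) (hsK : s ⊆ K) (h : ∀ x ∈ K, ∀ᶠ w in 𝓝[≠] x, w ∉ s) : s.Finite := by
  by_contra hinf
  obtain ⟨x, hxK, hx⟩ := Set.Infinite.exists_accPt_of_subset_isCompact hinf hK hsK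
  exact accPt_iff_frequently_nhdsNE.1 hx (h x hxK)

section ArgumentPrinciple

variable {g : ℂ → ℂ} {k : ℂ → ℤ} {X U K : Set ℂ} {Q : Finset ℂ}

theorem HasIndexAt.exists_eq_zpow_mul {q : ℂ} {n : ℤ} (hq : HasIndexAt g q n)
    (hg : ContinuousOn g (X \ {q})) :
    ∃ L g' : ℂ → ℂ, ContinuousOn L {q}ᶜ ∧ ContinuousOn g' X ∧ g' q ≠ 0 ∧
      ∀ w ≠ q, g w = (w - q) ^ n * exp (L w) * g' w := by
  obtain ⟨L, hL, hgL⟩ := hq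
  have hm : ∀ v ≠ q, (v - q) ^ n * exp (L v) ≠ 0 := fun v hv =>
    mul_ne_zero (zpow_ne_zero _ (sub_ne_zero.2 hv)) (exp_ne_zero _)
  refine ⟨L, Function.update (fun w => g w / ((w - q) ^ n * exp (L w))) q 1, hL, fun w hw => ?_,
    by rw [Function.update_self]; exact one_ne_zero,
    fun w hw => by rw [Function.update_of_ne hw, mul_div_cancel₀ _ (hm w hw)]⟩
  rcases eq_or_ne w q with rfl | hwq
  · refine ((continuousAt_const (y := (1 : ℂ))).congr ?_).continuousWithinAt
    filter_upwards [eventually_nhdsWithin_iff.1 hgL] with v hv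
    rcases eq_or_ne v w with rfl | hvw
    · rw [Function.update_self]
    · rw [Function.update_of_ne hvw, hv hvw, div_self (hm v hvw)]
  · have hdiv : ContinuousOn (fun v => g v / ((v - q) ^ n * exp (L v))) (X \ {q}) :=
      hg.div ((continuousOn_zpow_mul_exp hL).mono fun v hv => hv.2) fun v hv => hm v hv.2
    rw [continuousWithinAt_update_of_ne hwq]
    exact (hdiv w ⟨hw, hwq⟩).mono_of_mem_nhdsWithin
      (inter_mem_nhdsWithin X (isOpen_compl_singleton.mem_nhds hwq))

theorem HasIndexAt.of_eq_zpow_mul {q z : ℂ} {n l : ℤ} {L g' : ℂ → ℂ} (hz : HasIndexAt g z l)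
    (hzq : z ≠ q) (hL : ContinuousOn L {q}ᶜ)
    (hgg' : ∀ w ≠ q, g w = (w - q) ^ n * exp (L w) * g' w) : HasIndexAt g' z l := by
  have hm : ∀ w ≠ q, (w - q) ^ n * exp (L w) ≠ 0 := fun w hw =>
    mul_ne_zero (zpow_ne_zero _ (sub_ne_zero.2 hw)) (exp_ne_zero _)
  have hinv : HasIndexAt (fun w => ((w - q) ^ n * exp (L w))⁻¹) z 0 := by
    refine hasIndexAt_zero_of_continuousAt (inv_ne_zero (hm z hzq)) ?_
    filter_upwards [isOpen_compl_singleton.mem_nhds hzq] with w hw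
    exact ((continuousOn_zpow_mul_exp hL).continuousAt
      (isOpen_compl_singleton.mem_nhds hw)).inv₀ (hm w hw)
  rw [← zero_add l]
  refine (hinv.mul hz).congr ?_
  filter_upwards [nhdsWithin_le_nhds (isOpen_compl_singleton.mem_nhds hzq)] with w hw
  rw [hgg' w hw, inv_mul_cancel_left₀ (hm w hw)]

theorem exists_continuousOn_winding_eq_add_sum (hg : ContinuousOn g (X \ Q))
    (h0 : ∀ z ∈ X \ Q, g z ≠ 0) (hk : ∀ z ∈ Q, HasIndexAt g z (k z)) :
    ∃ g₀ : ℂ → ℂ, ContinuousOn g₀ X ∧ (∀ z ∈ X, g₀ z ≠ 0) ∧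
      ∀ (c : ℝ → ℂ) (a b : ℝ), IsClosedCurve c a b → MapsTo c (Icc a b) (X \ Q) →
        winding (fun t => g (c t)) a b =
          winding (fun t => g₀ (c t)) a b + ∑ z ∈ Q, k z * windingNumber c a b z := by
  induction Q using Finset.induction_on generalizing g with
  | empty =>
    simp only [Finset.coe_empty, sdiff_empty] at hg h0
    exact ⟨g, hg, h0, fun c a b _ _ => by rw [Finset.sum_empty, add_zero]⟩
  | insert q Q hqQ ih =>
    have hsub : X \ ↑(insert q Q) = (X \ Q) \ {q} := by
      rw [Finset.coe_insert, sdiff_sdiff, union_comm, ← insert_eq]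
    rw [hsub] at hg h0
    obtain ⟨L, g', hL, hg', hq0, hgg'⟩ := (hk q (Q.mem_insert_self q)).exists_eq_zpow_mul hg
    have h0' : ∀ z ∈ X \ Q, g' z ≠ 0 := fun z hz => by
      rcases eq_or_ne z q with rfl | hzq
      · exact hq0
      · exact right_ne_zero_of_mul (hgg' z hzq ▸ h0 z ⟨hz, hzq⟩)
    obtain ⟨g₀, hg₀, hg₀0, hwind⟩ := ih hg' h0' fun z hz =>
      (hk z (Finset.mem_insert_of_mem hz)).of_eq_zpow_mul (ne_of_mem_of_not_mem hz hqQ) hL hgg'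
    refine ⟨g₀, hg₀, hg₀0, fun c a b hc hcX => ?_⟩
    rw [hsub] at hcX
    have hcQ : MapsTo c (Icc a b) (X \ Q) := fun t ht => (hcX ht).1
    have hcq : MapsTo c (Icc a b) {q}ᶜ := fun t ht => (hcX ht).2
    have hsplit : winding (fun t => g (c t)) a b =
        k q * windingNumber c a b q + winding (fun t => g' (c t)) a b := by
      have hm := hc.comp (continuousOn_zpow_mul_exp (k := k q) hL) hcq
      rw [winding_congr fun t ht => hgg' _ (hcq ht),
        winding_mul hc.le hm.continuousOn
          (fun t ht => mul_ne_zero (zpow_ne_zero _ (sub_ne_zero.2 (hcq ht))) (exp_ne_zero _))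
          (hc.comp hg' hcQ).continuousOn fun t ht => h0' _ (hcQ ht),
        hc.winding_zpow_mul_exp hcq hL]
    rw [hsplit, hwind c a b hc hcQ, Finset.sum_insert hqQ]
    ring

theorem IsClosedCurve.winding_comp_eq_sum_of_convex {c : ℝ → ℂ} {a b : ℝ}
    (hc : IsClosedCurve c a b) (hU : IsOpen U) (hconv : Convex ℝ U)
    (hcU : MapsTo c (Icc a b) (U \ Q)) (hg : ContinuousOn g (U \ Q))
    (h0 : ∀ z ∈ U \ Q, g z ≠ 0) (hk : ∀ z ∈ Q, HasIndexAt g z (k z)) :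
    winding (fun t => g (c t)) a b = ∑ z ∈ Q, k z * windingNumber c a b z := by
  have hcU' : MapsTo c (Icc a b) U := fun t ht => (hcU ht).1
  obtain ⟨g₀, hg₀, hg₀0, hwind⟩ := exists_continuousOn_winding_eq_add_sum hg h0 hk
  obtain ⟨L, hL, hLg⟩ := exists_log_of_convex hU hconv ⟨c a, hcU' (left_mem_Icc.2 hc.le)⟩ hg₀ hg₀0
  rw [hwind c a b hc hcU, winding_congr fun t ht => hLg _ (hcU' ht), (hc.comp hL hcU').winding_exp,
    zero_add]

theorem exists_differentiable_norm_sub_lt (hK : IsCompact K) (hg : ContinuousOn g K)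
    (h0 : ∀ z ∈ K, g z ≠ 0) :
    ∃ G : ℂ → ℂ, Differentiable ℝ G ∧ (∀ z, G z = 0 → jacobian G z ≠ 0) ∧
      ∀ z ∈ K, ‖G z - g z‖ < ‖g z‖ := by
  obtain ⟨δ, hδ, hle⟩ := hK.exists_forall_le' hg.norm fun z hz => norm_pos_iff.2 (h0 z hz)
  obtain ⟨T, hT⟩ := ContinuousMap.exists_restrict_eq hK.isClosed
    ⟨K.domRestrict g, continuousOn_iff_continuous_domRestrict.1 hg⟩
  have hTg : ∀ z ∈ K, T z = g z := fun z hz => DFunLike.congr_fun hT ⟨z, hz⟩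
  obtain ⟨P, hP, hPT, -⟩ := T.continuous.exists_contDiff_approx 1 continuous_const
    fun _ => half_pos hδ
  have hPd : Differentiable ℝ P := hP.differentiable one_ne_zero
  obtain ⟨ε, hε, hreg⟩ := exists_regular_value_norm_lt hPd (half_pos hδ)
  refine ⟨fun z => P z - ε, hPd.sub_const ε, fun z hz => ?_, fun z hz => ?_⟩
  · rw [jacobian_sub_const]
    exact hreg z (sub_eq_zero.1 hz)
  · have happrox := hPT z
    rw [dist_eq_norm, hTg z hz] at happrox
    calc ‖P z - ε - g z‖ = ‖(P z - g z) - ε‖ := by congr 1; ring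
      _ ≤ ‖P z - g z‖ + ‖ε‖ := norm_sub_le _ _
      _ < ‖g z‖ := by linarith [hle z hz]

theorem exists_hasIndexAt_of_jacobian_ne_zero (hg : Differentiable ℝ g)
    (hreg : ∀ z, g z = 0 → jacobian g z ≠ 0) (z : ℂ) : ∃ n : ℤ, HasIndexAt g z n := by
  have hc : ∀ᶠ w in 𝓝 z, ContinuousAt g w := .of_forall fun w => hg.continuous.continuousAt
  by_cases hz : g z = 0
  · rcases (hreg z hz).lt_or_gt with hJ | hJ
    · exact ⟨-1, hasIndexAt_neg_one_of_jacobian_neg hz (hg z) hc hJ⟩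
    · exact ⟨1, hasIndexAt_one_of_jacobian_pos hz (hg z) hc hJ⟩
  · exact ⟨0, hasIndexAt_zero_of_continuousAt hz hc⟩

section Family

variable {ι : Type*} [Fintype ι] {c : ι → ℝ → ℂ} {a b : ι → ℝ}

theorem sum_winding_comp_eq_zero (hK : IsCompact K) (hc : ∀ i, IsClosedCurve (c i) (a i) (b i))
    (hcK : ∀ i, MapsTo (c i) (Icc (a i) (b i)) K)
    (hnull : ∀ p ∉ K, ∑ i, windingNumber (c i) (a i) (b i) p = 0) (hg : ContinuousOn g K)
    (h0 : ∀ z ∈ K, g z ≠ 0) : ∑ i, winding (fun t => g (c i t)) (a i) (b i) = 0 := by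
  obtain ⟨G, hG, hreg, hGg⟩ := exists_differentiable_norm_sub_lt hK hg h0
  choose k hk using exists_hasIndexAt_of_jacobian_ne_zero hG hreg
  obtain ⟨R, hKR⟩ := hK.isBounded.subset_ball 0
  have hfin : {z ∈ Metric.closedBall (0 : ℂ) R | G z = 0}.Finite :=
    finite_of_eventually_notMem (isCompact_closedBall 0 R) (sep_subset _ _) fun z _ =>
      (hk z).eventually_ne_zero.mono fun w hw hmem => hw hmem.2
  have hZK : ∀ z ∈ hfin.toFinset, z ∉ K := fun z hz hzK => by
    have h := hGg z hzK
    rw [(hfin.mem_toFinset.1 hz).2, zero_sub, norm_neg] at h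
    exact h.false
  have hGc := hG.continuous.continuousOn (s := Metric.ball 0 R \ hfin.toFinset)
  have hG0 : ∀ z ∈ Metric.ball 0 R \ hfin.toFinset, G z ≠ 0 := fun z hz h =>
    hz.2 (hfin.mem_toFinset.2 ⟨Metric.ball_subset_closedBall hz.1, h⟩)
  have hwind : ∀ i, winding (fun t => g (c i t)) (a i) (b i) =
      ∑ z ∈ hfin.toFinset, k z * windingNumber (c i) (a i) (b i) z := fun i => by
    rw [← (hc i).winding_comp_eq_sum_of_convex Metric.isOpen_ball (convex_ball 0 R)
      (fun t ht => ⟨hKR (hcK i ht), fun h => hZK _ h (hcK i ht)⟩) hGc hG0 fun z _ => hk z]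
    exact (((hc i).comp hg (hcK i)).winding_eq_of_norm_sub_lt
      ((hc i).comp hG.continuous.continuousOn (mapsTo_univ _ _))
      fun t ht => hGg _ (hcK i ht)).symm
  simp only [hwind]
  rw [Finset.sum_comm]
  exact Finset.sum_eq_zero fun z hz => by rw [← Finset.mul_sum, hnull z (hZK z hz), mul_zero]

theorem sum_winding_comp_eq_sum (hK : IsCompact K) (hc : ∀ i, IsClosedCurve (c i) (a i) (b i))
    (hcK : ∀ i, MapsTo (c i) (Icc (a i) (b i)) (K \ Q))
    (hnull : ∀ p ∉ K, ∑ i, windingNumber (c i) (a i) (b i) p = 0) (hg : ContinuousOn g (K \ Q))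
    (h0 : ∀ z ∈ K \ Q, g z ≠ 0) (hk : ∀ z ∈ Q, HasIndexAt g z (k z)) :
    ∑ i, winding (fun t => g (c i t)) (a i) (b i) =
      ∑ z ∈ Q, k z * ∑ i, windingNumber (c i) (a i) (b i) z := by
  obtain ⟨g₀, hg₀, hg₀0, hwind⟩ := exists_continuousOn_winding_eq_add_sum hg h0 hk
  simp only [fun i => hwind _ _ _ (hc i) (hcK i)]
  rw [Finset.sum_add_distrib, sum_winding_comp_eq_zero hK hc
    (fun i t ht => (hcK i ht).1) hnull hg₀ hg₀0, zero_add, Finset.sum_comm]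
  simp only [Finset.mul_sum]

end Family

end ArgumentPrinciple

section Jump

variable {ω : ℂ → ℂ} {c : ℝ → ℂ} {a b t₀ : ℝ} {z₀ : ℂ}

theorem exists_nhds_abs_winding_comp_sub_le (hω : AnalyticAt ℂ ω z₀) (hd : deriv ω z₀ ≠ 0) :
    ∃ U ∈ 𝓝 z₀, ∀ (c : ℝ → ℂ) (a b : ℝ), a ≤ b → ContinuousOn c (Icc a b) →
      MapsTo c (Icc a b) U → ∀ x ∈ U, (∀ t ∈ Icc a b, ω (c t) ≠ ω x) →
        |winding (fun t => ω (c t) - ω x) a b - winding (fun t => c t - x) a b| ≤ 1 / 8 := by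
  set d := deriv ω z₀
  have hstrict : ∀ᶠ p : ℂ × ℂ in 𝓝 z₀ ×ˢ 𝓝 z₀,
      ‖ω p.1 - ω p.2 - d * (p.1 - p.2)‖ ≤ 1 / 4 * ‖d * (p.1 - p.2)‖ := by
    have hlittle := (hasStrictFDerivAt_iff_isLittleO.1
      hω.hasStrictDerivAt.hasStrictFDerivAt).def (show 0 < 1 / 4 * ‖d‖ by positivity)
    rw [nhds_prod_eq] at hlittle
    filter_upwards [hlittle] with p hp
    rw [ContinuousLinearMap.toSpanSingleton_apply, smul_eq_mul, mul_comm (p.1 - p.2)] at hp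
    rwa [norm_mul d, ← mul_assoc]
  obtain ⟨V, hV, hstrictV⟩ := eventually_prod_self_iff
    (r := fun z w => ‖ω z - ω w - d * (z - w)‖ ≤ 1 / 4 * ‖d * (z - w)‖).1 hstrict
  refine ⟨V ∩ {z | ContinuousAt ω z},
    inter_mem hV (hω.eventually_analyticAt.mono fun z hz => hz.continuousAt),
    fun c a b hab hc hcU x hx hne => ?_⟩
  have hcx : ContinuousOn (fun t => c t - x) (Icc a b) := hc.sub continuousOn_const
  have hcx0 : ∀ t ∈ Icc a b, c t - x ≠ 0 := fun t ht h =>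
    hne t ht (congrArg ω (sub_eq_zero.1 h))
  have hωc : ContinuousOn (fun t => ω (c t) - ω x) (Icc a b) := fun t ht =>
    ((hcU ht).2.comp_continuousWithinAt (hc t ht)).sub continuousWithinAt_const
  have hdcx : ContinuousOn (fun t => d * (c t - x)) (Icc a b) := hcx.const_mul d
  have hscale : winding (fun t => d * (c t - x)) a b = winding (fun t => c t - x) a b := by
    rw [winding_mul hab continuousOn_const (fun _ _ => hd) hcx hcx0, winding_const hd hab,
      zero_add]
  have hdcx0 : ∀ t ∈ Icc a b, d * (c t - x) ≠ 0 := fun t ht => mul_ne_zero hd (hcx0 t ht)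
  rw [← hscale, ← winding_div hab hωc (fun t ht => sub_ne_zero.2 (hne t ht)) hdcx hdcx0]
  have hquarter := abs_winding_le_of_norm_sub_one_le (ε := 1 / 4) (by norm_num) hab
    (hωc.div hdcx hdcx0) fun t ht => by
      rw [Pi.div_apply, div_sub_one (hdcx0 t ht), norm_div,
        div_le_iff₀ (norm_pos_iff.2 (hdcx0 t ht))]
      exact hstrictV _ (hcU ht).1 _ hx.1
  exact hquarter.trans_eq (by norm_num)

theorem exists_tendsto_winding_sub_winding_near (hc : ContinuousOn c (Icc a b)) {a' b' : ℝ}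
    (ha : a ≤ a') (hab' : a' ≤ b') (hb : b' ≤ b)
    (honce : ∀ t ∈ Icc a b, c t = z₀ → t ∈ Ioo a' b') :
    ∃ κ, Tendsto (fun x => winding (fun t => c t - x) a b - winding (fun t => c t - x) a' b')
      (𝓝[(c '' Icc a b)ᶜ] z₀) (𝓝 κ) := by
  have hleft := continuousAt_winding_sub (p := z₀) ha
    (hc.mono (Icc_subset_Icc_right (hab'.trans hb))) fun ⟨t, ht, htz⟩ =>
      (honce t ⟨ht.1, ht.2.trans (hab'.trans hb)⟩ htz).1.not_ge ht.2
  have hright := continuousAt_winding_sub (p := z₀) hb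
    (hc.mono (Icc_subset_Icc_left (ha.trans hab'))) fun ⟨t, ht, htz⟩ =>
      (honce t ⟨(ha.trans hab').trans ht.1, ht.2⟩ htz).2.not_ge ht.1
  refine ⟨_, ((hleft.add hright).tendsto.mono_left nhdsWithin_le_nhds).congr' ?_⟩
  filter_upwards [self_mem_nhdsWithin] with x hx
  have hcx : ContinuousOn (fun t => c t - x) (Icc a b) := hc.sub continuousOn_const
  have hcx0 : ∀ t ∈ Icc a b, c t - x ≠ 0 := fun t ht h => hx ⟨t, ht, sub_eq_zero.1 h⟩
  rw [Pi.add_apply, winding_add_adjacent ⟨ha, hab'.trans hb⟩ hcx hcx0,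
    winding_add_adjacent ⟨hab', hb⟩ (hcx.mono (Icc_subset_Icc_left ha))
      fun t ht => hcx0 t (Icc_subset_Icc_left ha ht)]
  ring

theorem circleMap_zero_one (t : ℝ) : circleMap 0 1 t = exp (t * I) := by simp [circleMap]

theorem eq_of_circleMap_eq {z : ℂ} {R s t : ℝ} (hR : R ≠ 0) (hst : |s - t| < 2 * Real.pi)
    (h : circleMap z R s = circleMap z R t) : s = t := by
  obtain ⟨hlt, hgt⟩ := abs_lt.1 hst
  obtain hle | hle := le_total s t
  · exact injOn_circleMap_of_abs_sub_le' hR (a := s) (b := s + 2 * Real.pi) (by linarith)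
      ⟨le_rfl, by linarith⟩ ⟨hle, by linarith⟩ h
  · exact injOn_circleMap_of_abs_sub_le' hR (a := t) (b := t + 2 * Real.pi) (by linarith)
      ⟨hle, by linarith⟩ ⟨le_rfl, by linarith⟩ h

theorem exists_tendsto_winding_circleMap_sub_near {δ : ℝ} (hδ : 0 < δ) (hδπ : δ ≤ Real.pi) :
    ∃ κ, Tendsto (fun w =>
        winding (fun t => circleMap 0 1 t - w) (t₀ - Real.pi) (t₀ - Real.pi + 2 * Real.pi) -
          winding (fun t => circleMap 0 1 t - w) (t₀ - δ) (t₀ + δ))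
      (𝓝[(circleMap 0 1 '' Icc (t₀ - Real.pi) (t₀ - Real.pi + 2 * Real.pi))ᶜ] circleMap 0 1 t₀)
      (𝓝 κ) :=
  exists_tendsto_winding_sub_winding_near (continuous_circleMap 0 1).continuousOn
    (by linarith) (by linarith) (by linarith) fun t ht htz => by
      have hπ : |t - t₀| < 2 * Real.pi := by
        rw [abs_lt]
        constructor <;> linarith [ht.1, ht.2, Real.pi_pos]
      rw [eq_of_circleMap_eq one_ne_zero hπ htz]
      constructor <;> linarith

theorem exists_Icc_sub_add_subset {t ε : ℝ} {s : Set ℝ} (hε : 0 < ε) (hs : s ∈ 𝓝 t) :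
    ∃ δ, 0 < δ ∧ δ ≤ ε ∧ Icc (t - δ) (t + δ) ⊆ s := by
  obtain ⟨δ, hδ, hsub⟩ := Metric.nhds_basis_closedBall.mem_iff.1 hs
  refine ⟨min δ ε, lt_min hδ hε, min_le_right δ ε, ?_⟩
  rw [← Real.closedBall_eq_Icc]
  exact (Metric.closedBall_subset_closedBall (min_le_left δ ε)).trans hsub

/-- Near `z₀`, the winding numbers of `c` and of the unit circle differ by almost a constant, since
`ω` maps the only passage of `c` through `z₀` to an arc of the unit circle. -/
theorem exists_abs_windingNumber_sub_circleMap_lt (hω : AnalyticAt ℂ ω z₀)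
    (hd : deriv ω z₀ ≠ 0) (hc : ContinuousOn c (Icc a b))
    (hcω : ∀ t ∈ Icc a b, ω (c t) = exp (t * I)) (ht₀ : t₀ ∈ Ioo a b) (hct₀ : c t₀ = z₀)
    (honce : ∀ t ∈ Icc a b, c t = z₀ → t = t₀) :
    ∃ κ : ℝ, ∀ᶠ x in 𝓝 z₀, ‖ω x‖ ≠ 1 →
      |windingNumber c a b x -
        windingNumber (circleMap 0 1) (t₀ - Real.pi) (t₀ - Real.pi + 2 * Real.pi) (ω x) - κ|
        < 1 / 2 := by
  obtain ⟨U, hU, hmid⟩ := exists_nhds_abs_winding_comp_sub_le hω hd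
  have hωz₀ : circleMap 0 1 t₀ = ω z₀ := by
    rw [← hct₀, hcω t₀ (Ioo_subset_Icc_self ht₀), circleMap_zero_one]
  have hIcc := Icc_mem_nhds ht₀.1 ht₀.2
  obtain ⟨δ, hδ, hδπ, hδsub⟩ := exists_Icc_sub_add_subset Real.pi_pos
    (inter_mem hIcc ((hc.continuousAt hIcc).preimage_mem_nhds (hct₀ ▸ hU)))
  have hle : t₀ - δ ≤ t₀ + δ := by linarith
  have hsub : Icc (t₀ - δ) (t₀ + δ) ⊆ Icc a b := fun t ht => (hδsub ht).1
  obtain ⟨κ₁, hκ₁⟩ := exists_tendsto_winding_sub_winding_near hc (hsub (left_mem_Icc.2 hle)).1 hle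
    (hsub (right_mem_Icc.2 hle)).2 fun t ht htz => by
      rw [honce t ht htz]
      constructor <;> linarith
  obtain ⟨κ₂, hκ₂⟩ := exists_tendsto_winding_circleMap_sub_near (t₀ := t₀) hδ hδπ
  rw [hωz₀] at hκ₂
  refine ⟨κ₁ - κ₂, ?_⟩
  have h₁ := eventually_nhdsWithin_iff.1 (hκ₁.eventually (Metric.ball_mem_nhds κ₁ (ε := 1 / 8)
    (by norm_num)))
  have h₂ := hω.continuousAt.eventually (eventually_nhdsWithin_iff.1
    (hκ₂.eventually (Metric.ball_mem_nhds κ₂ (ε := 1 / 8) (by norm_num))))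
  filter_upwards [hU, h₁, h₂] with x hxU hx₁ hx₂ hx
  have hcx : ∀ t ∈ Icc a b, ω (c t) ≠ ω x := fun t ht h => hx (by
    rw [← h, hcω t ht, norm_exp_ofReal_mul_I])
  have hx₁ := hx₁ fun ⟨t, ht, htx⟩ => hcx t ht (congrArg ω htx)
  have hx₂ := hx₂ fun ⟨t, _, htx⟩ => hx (by simp [← htx])
  have hx₃ := hmid c _ _ hle (hc.mono hsub) (fun t ht => (hδsub ht).2) x hxU
    fun t ht => hcx t (hsub ht)
  have hωc : winding (fun t => ω (c t) - ω x) (t₀ - δ) (t₀ + δ) =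
      winding (fun t => circleMap 0 1 t - ω x) (t₀ - δ) (t₀ + δ) :=
    winding_congr fun t ht => by simp only [hcω t (hsub ht), circleMap_zero_one]
  rw [hωc] at hx₃
  rw [Real.dist_eq, abs_lt] at hx₁ hx₂
  rw [abs_le] at hx₃
  rw [windingNumber, windingNumber, abs_lt]
  constructor <;> linarith [hx₁.1, hx₁.2, hx₂.1, hx₂.2, hx₃.1, hx₃.2]

theorem exists_windingNumber_jump (hω : AnalyticAt ℂ ω z₀) (hd : deriv ω z₀ ≠ 0)
    (hc : IsClosedCurve c a b) (hcω : ∀ t ∈ Icc a b, ω (c t) = exp (t * I)) (ht₀ : t₀ ∈ Ioo a b)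
    (hct₀ : c t₀ = z₀) (honce : ∀ t ∈ Icc a b, c t = z₀ → t = t₀) :
    ∃ m : ℤ, ∀ᶠ x in 𝓝 z₀, (‖ω x‖ < 1 → windingNumber c a b x = m + 1) ∧
      (1 < ‖ω x‖ → windingNumber c a b x = m) := by
  obtain ⟨κ, hκ⟩ :=
    exists_abs_windingNumber_sub_circleMap_lt hω hd hc.continuousOn hcω ht₀ hct₀ honce
  refine ⟨round κ, ?_⟩
  filter_upwards [hκ] with x hx
  have exists_int (hx1 : ‖ω x‖ ≠ 1) : ∃ k : ℤ, windingNumber c a b x = k :=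
    (hc.sub_const x).exists_int_winding_eq fun t ht h => hx1 (by
      rw [← sub_eq_zero.1 h, hcω t ht, norm_exp_ofReal_mul_I])
  constructor
  · intro hlt
    obtain ⟨k, hk⟩ := exists_int hlt.ne
    have hnear := hx hlt.ne
    rw [windingNumber_circleMap_of_lt (by simpa using hlt), hk, abs_lt] at hnear
    have hround : round κ = k - 1 := round_eq_iff.2 (by push_cast; constructor <;> linarith)
    rw [hk, hround]
    push_cast
    ring
  · intro hgt
    obtain ⟨k, hk⟩ := exists_int hgt.ne'
    have hnear := hx hgt.ne'
    rw [windingNumber_circleMap_of_gt zero_le_one (by simpa using hgt), hk, abs_lt] at hnear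
    have hround : round κ = k := round_eq_iff.2 (by constructor <;> linarith)
    rw [hk, hround]

end Jump

namespace IsCritParam

variable {f : ℂ → ℂ} {B : Set ℂ} {n : ℕ} {a b : Fin n → ℝ} {γ : Fin n → ℝ → ℂ}

theorem isClosedCurve (hγ : IsCritParam f B a b γ) (j : Fin n) :
    IsClosedCurve (γ j) (a j) (b j) :=
  ⟨(hγ.lt j).le, hγ.continuousOn j, hγ.closed j⟩

theorem mem (hγ : IsCritParam f B a b γ) {j : Fin n} {t : ℝ} (ht : t ∈ Icc (a j) (b j)) :
    γ j t ∈ B :=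
  hγ.trace_eq ▸ mem_iUnion.2 ⟨j, t, ht, rfl⟩

theorem eventually_sum_windingNumber_eq (hγ : IsCritParam f B a b γ) {p : ℂ} (hp : p ∉ B) :
    ∀ᶠ q in 𝓝 p, ∑ j, windingNumber (γ j) (a j) (b j) q =
      ∑ j, windingNumber (γ j) (a j) (b j) p := by
  filter_upwards [eventually_all.2 fun j => (hγ.isClosedCurve j).eventually_windingNumber_eq
    (p := p) fun ⟨t, ht, htp⟩ => hp (htp ▸ hγ.mem ht)] with q hq
  exact Finset.sum_congr rfl fun j _ => hq j

theorem eventually_sum_windingNumber_eq_zero (hγ : IsCritParam f B a b γ) :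
    ∀ᶠ q in Bornology.cobounded ℂ, ∑ j, windingNumber (γ j) (a j) (b j) q = 0 := by
  filter_upwards [eventually_all.2 fun j =>
    (hγ.isClosedCurve j).eventually_windingNumber_eq_zero] with q hq
  exact Finset.sum_eq_zero fun j _ => hq j

theorem exists_sum_windingNumber_jump (hγ : IsCritParam f B a b γ) {z : ℂ} (hz : z ∈ B)
    (hω : AnalyticAt ℂ (dilatation f) z) (hd : deriv (dilatation f) z ≠ 0)
    (hza : ∀ j, γ j (a j) ≠ z) :
    ∃ m : ℝ, ∀ᶠ x in 𝓝 z,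
      (‖dilatation f x‖ < 1 → ∑ j, windingNumber (γ j) (a j) (b j) x = m + 1) ∧
      (1 < ‖dilatation f x‖ → ∑ j, windingNumber (γ j) (a j) (b j) x = m) := by
  obtain ⟨⟨j₀, t₀⟩, ⟨ht₀, hzt₀⟩, huniq⟩ := hγ.once z hz hd
  have honce : ∀ j, ∀ t ∈ Icc (a j) (b j), γ j t = z → j = j₀ ∧ t = t₀ := by
    intro j t ht htz
    have htb : t ≠ b j := by
      rintro rfl
      exact hza j (by rw [hγ.closed j, htz])
    have heq := huniq (j, t) ⟨⟨ht.1, ht.2.lt_of_ne htb⟩, htz⟩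
    exact ⟨congrArg Prod.fst heq, congrArg Prod.snd heq⟩
  have hat₀ : a j₀ ≠ t₀ := fun h => hza j₀ (h ▸ hzt₀)
  obtain ⟨m, hm⟩ := exists_windingNumber_jump hω hd (hγ.isClosedCurve j₀) (hγ.dilatation_eq j₀)
    ⟨ht₀.1.lt_of_ne hat₀, ht₀.2⟩ hzt₀ fun t ht htz => (honce j₀ t ht htz).2
  have hother : ∀ᶠ x in 𝓝 z, ∀ j, j ≠ j₀ →
      windingNumber (γ j) (a j) (b j) x = windingNumber (γ j) (a j) (b j) z :=
    eventually_all.2 fun j => eventually_imp_distrib_left.2 fun hj =>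
      (hγ.isClosedCurve j).eventually_windingNumber_eq
        fun ⟨t, ht, htz⟩ => hj (honce j t ht htz).1
  refine ⟨m + ∑ j ∈ Finset.univ.erase j₀, windingNumber (γ j) (a j) (b j) z, ?_⟩
  filter_upwards [hm, hother] with x hx hxother
  rw [← Finset.add_sum_erase _ _ (Finset.mem_univ j₀),
    Finset.sum_congr rfl fun j hj => hxother j (Finset.ne_of_mem_erase hj)]
  exact ⟨fun h => by rw [hx.1 h]; ring, fun h => by rw [hx.2 h]⟩

end IsCritParam

open InnerProductSpace

theorem analyticAt_dz {f : ℂ → ℂ} {z : ℂ} (hf : HarmonicAt f z) : AnalyticAt ℂ (dz f) z := by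
  have hu := HarmonicAt.analyticAt_complex_partial (hf.comp_CLM reCLM)
  have hv := HarmonicAt.analyticAt_complex_partial (hf.comp_CLM imCLM)
  refine ((hu.add (analyticAt_const (v := I) |>.mul hv)).div (analyticAt_const (v := 2))
    two_ne_zero).congr ?_
  filter_upwards [hf.eventually] with w hw
  have hd : DifferentiableAt ℝ f w := hw.1.differentiableAt two_ne_zero
  have hre : ∀ v, fderiv ℝ (reCLM ∘ f) w v = (fderiv ℝ f w v).re := fun v => by
    rw [fderiv_comp w reCLM.differentiableAt hd]; simp
  have him : ∀ v, fderiv ℝ (imCLM ∘ f) w v = (fderiv ℝ f w v).im := fun v => by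
    rw [fderiv_comp w imCLM.differentiableAt hd]; simp
  simp only [Pi.add_apply, Pi.mul_apply, Pi.div_apply, hre, him, dz]
  conv_rhs => rw [← re_add_im (fderiv ℝ f w 1), ← re_add_im (fderiv ℝ f w I)]
  ring

theorem analyticAt_conj_dzbar {f : ℂ → ℂ} {z : ℂ} (hf : HarmonicAt f z) :
    AnalyticAt ℂ (fun w => (starRingEnd ℂ) (dzbar f w)) z := by
  refine (analyticAt_dz (hf.comp_CLM (conjCLE : ℂ →L[ℝ] ℂ))).congr ?_
  filter_upwards [hf.eventually] with w hw
  exact (hasWirtingerDerivAt_of_differentiableAt (hw.1.differentiableAt two_ne_zero)).conj.dz_eq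

/-- `f` has a pole of order `n` at `z₀` in the sense of harmonic mappings, with the polar parts of
its analytic and anti-analytic parts given by `H` and `G` and with logarithmic coefficient `c`. The
case `n = 0` and the cancellation `‖H z₀‖ = ‖G z₀‖` are not excluded. -/
structure HasHarmonicPoleAt (f H G : ℂ → ℂ) (z₀ c : ℂ) (n : ℕ) : Prop where
  analyticAt_left : AnalyticAt ℂ H z₀
  analyticAt_right : AnalyticAt ℂ G z₀
  eventually_eq : ∀ᶠ z in 𝓝[≠] z₀, f z = H z / (z - z₀) ^ n +
    (starRingEnd ℂ) (G z / (z - z₀) ^ n) + c * (Real.log ‖z - z₀‖ : ℂ)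

theorem hasDerivAt_div_sub_pow {F : ℂ → ℂ} {z z₀ : ℂ} (hF : DifferentiableAt ℂ F z)
    (hz : z ≠ z₀) (n : ℕ) : HasDerivAt (fun w => F w / (w - z₀) ^ n)
      ((deriv F z * (z - z₀) - n * F z) / (z - z₀) ^ (n + 1)) z := by
  have hz0 : z - z₀ ≠ 0 := sub_ne_zero.2 hz
  refine (hF.hasDerivAt.div (((hasDerivAt_id z).sub_const z₀).pow n)
    (pow_ne_zero n hz0)).congr_deriv ?_
  rcases n with _ | n
  · simp [hz0]
  · simp only [id_eq, Pi.pow_apply, Nat.add_sub_cancel, mul_one]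
    field_simp
    ring

theorem tendsto_log_norm_mul_pow (z₀ c : ℂ) {n : ℕ} (hn : 1 ≤ n) :
    Tendsto (fun z => ‖c * (Real.log ‖z - z₀‖ : ℂ)‖ * ‖z - z₀‖ ^ n) (𝓝 z₀) (𝓝 0) := by
  obtain ⟨m, rfl⟩ := Nat.exists_eq_add_of_le' hn
  have hcont : Continuous fun z : ℂ => ‖c‖ * (|‖z - z₀‖ * Real.log ‖z - z₀‖| * ‖z - z₀‖ ^ m) :=
    continuous_const.mul (((Real.continuous_mul_log.comp
      (continuous_id.sub continuous_const).norm).abs).mul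
        ((continuous_id.sub continuous_const).norm.pow m))
  have hlim := hcont.tendsto z₀
  simp only [sub_self, norm_zero, zero_mul, abs_zero, mul_zero] at hlim
  refine hlim.congr fun z => ?_
  rw [norm_mul, norm_real, Real.norm_eq_abs, abs_mul, abs_norm]
  ring

namespace HasHarmonicPoleAt

variable {f H G : ℂ → ℂ} {z₀ c : ℂ} {n : ℕ}

theorem conj (h : HasHarmonicPoleAt f H G z₀ c n) :
    HasHarmonicPoleAt (fun z => (starRingEnd ℂ) (f z)) G H z₀ ((starRingEnd ℂ) c) n := by
  refine ⟨h.analyticAt_right, h.analyticAt_left, h.eventually_eq.mono fun z hz => ?_⟩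
  rw [hz, map_add, map_add, map_mul, conj_conj, conj_ofReal]
  ring

theorem eventually_hasWirtingerDerivAt (h : HasHarmonicPoleAt f H G z₀ c n) :
    ∀ᶠ z in 𝓝[≠] z₀, HasWirtingerDerivAt f
      ((deriv H z * (z - z₀) - n * H z + c / 2 * (z - z₀) ^ n) / (z - z₀) ^ (n + 1))
      ((starRingEnd ℂ) ((deriv G z * (z - z₀) - n * G z +
        (starRingEnd ℂ) c / 2 * (z - z₀) ^ n) / (z - z₀) ^ (n + 1))) z := by
  filter_upwards [nhdsWithin_le_nhds h.analyticAt_left.eventually_analyticAt,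
    nhdsWithin_le_nhds h.analyticAt_right.eventually_analyticAt,
    eventually_eventually_nhdsWithin.2 h.eventually_eq, self_mem_nhdsWithin] with z hH hG hf hne
  rw [isOpen_compl_singleton.nhdsWithin_eq hne] at hf
  have hz : z - z₀ ≠ 0 := sub_ne_zero.2 hne
  have hz' : (starRingEnd ℂ) (z - z₀) ≠ 0 := (map_ne_zero _).2 hz
  have hsum := (((hasWirtingerDerivAt_of_hasDerivAt
    (hasDerivAt_div_sub_pow hH.differentiableAt hne n)).add (hasWirtingerDerivAt_of_hasDerivAt
    (hasDerivAt_div_sub_pow hG.differentiableAt hne n)).conj).add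
    ((hasWirtingerDerivAt_log_norm_sub hne).const_mul c)).congr_of_eventuallyEq hf
  convert hsum using 1
  · rw [map_zero]
    field_simp
    ring
  · simp only [map_add, map_mul, map_div₀, conj_conj, map_one, map_ofNat, map_pow]
    field_simp
    ring

theorem jacobian_pos (h : HasHarmonicPoleAt f H G z₀ c n) (hn : 1 ≤ n)
    (hlt : ‖G z₀‖ < ‖H z₀‖) : ∀ᶠ z in 𝓝[≠] z₀, 0 < jacobian f z := by
  have hlim : ∀ (F : ℂ → ℂ) (d : ℂ), AnalyticAt ℂ F z₀ →
      Tendsto (fun z => ‖deriv F z * (z - z₀) - n * F z + d / 2 * (z - z₀) ^ n‖) (𝓝[≠] z₀)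
        (𝓝 (n * ‖F z₀‖)) := fun F d hF => by
    have hcont : ContinuousAt
        (fun z => ‖deriv F z * (z - z₀) - n * F z + d / 2 * (z - z₀) ^ n‖) z₀ := by
      have := hF.deriv.continuousAt
      have := hF.continuousAt
      fun_prop
    have htendsto := hcont.tendsto
    simp only [sub_self, mul_zero, zero_sub, zero_pow (Nat.one_le_iff_ne_zero.1 hn), add_zero,
      norm_neg, norm_mul, norm_natCast] at htendsto
    exact htendsto.mono_left nhdsWithin_le_nhds
  have hnum := (hlim G ((starRingEnd ℂ) c) h.analyticAt_right).eventually_lt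
    (hlim H c h.analyticAt_left) (mul_lt_mul_of_pos_left hlt (Nat.cast_pos.2 hn))
  filter_upwards [h.eventually_hasWirtingerDerivAt, hnum, self_mem_nhdsWithin] with z hz hlt hne
  rw [hz.jacobian_eq, sub_pos, norm_conj, norm_div, norm_div]
  gcongr
  exact norm_pos_iff.2 (pow_ne_zero _ (sub_ne_zero.2 hne))

theorem hasIndexAt_neg (h : HasHarmonicPoleAt f H G z₀ c n) (hn : 1 ≤ n)
    (hlt : ‖G z₀‖ < ‖H z₀‖) : HasIndexAt f z₀ (-n) := by
  have hlim : Tendsto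
      (fun z => ‖H z - H z₀‖ + ‖G z‖ + ‖c * (Real.log ‖z - z₀‖ : ℂ)‖ * ‖z - z₀‖ ^ n)
      (𝓝[≠] z₀) (𝓝 ‖G z₀‖) := by
    have hcont : ContinuousAt (fun z => ‖H z - H z₀‖ + ‖G z‖) z₀ := by
      have := h.analyticAt_left.continuousAt
      have := h.analyticAt_right.continuousAt
      fun_prop
    have htendsto := hcont.tendsto.add (tendsto_log_norm_mul_pow z₀ c hn)
    simp only [sub_self, norm_zero, zero_add, add_zero] at htendsto
    exact htendsto.mono_left nhdsWithin_le_nhds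
  have hlead : HasIndexAt (fun z => H z₀ * (z - z₀) ^ (-n : ℤ)) z₀ (-n) := by
    simpa only [zero_add] using (hasIndexAt_const
      (norm_pos_iff.1 ((norm_nonneg _).trans_lt hlt)) z₀).mul (hasIndexAt_zpow z₀ (-n))
  refine hlead.of_norm_sub_lt (h.eventually_hasWirtingerDerivAt.mono fun z hz =>
    hz.differentiableAt.continuousAt) ?_
  filter_upwards [h.eventually_eq, hlim.eventually_lt_const hlt, self_mem_nhdsWithin] with
    z hz hlt' hne
  have hpos : 0 < ‖z - z₀‖ ^ n := pow_pos (norm_pos_iff.2 (sub_ne_zero.2 hne)) n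
  rw [zpow_neg, zpow_natCast, ← div_eq_mul_inv, norm_div, norm_pow, lt_div_iff₀ hpos, hz]
  refine lt_of_le_of_lt ?_ hlt'
  calc _ = ‖(H z - H z₀) / (z - z₀) ^ n + (starRingEnd ℂ) (G z / (z - z₀) ^ n) +
          c * (Real.log ‖z - z₀‖ : ℂ)‖ * ‖z - z₀‖ ^ n := by congr 2; ring
    _ ≤ (‖H z - H z₀‖ / ‖z - z₀‖ ^ n + ‖G z‖ / ‖z - z₀‖ ^ n +
          ‖c * (Real.log ‖z - z₀‖ : ℂ)‖) * ‖z - z₀‖ ^ n := by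
        refine mul_le_mul_of_nonneg_right ((norm_add₃_le).trans_eq ?_) hpos.le
        rw [norm_conj, norm_div, norm_div, norm_pow]
    _ = _ := by field_simp

theorem exists_sign_and_index (h : HasHarmonicPoleAt f H G z₀ c n) (hn : 1 ≤ n)
    (hne : ‖H z₀‖ ≠ ‖G z₀‖) : ∃ σ : ℤˣ, (∀ᶠ z in 𝓝[≠] z₀, 0 < ((σ : ℤ) : ℝ) * jacobian f z) ∧
      HasIndexAt f z₀ (-(σ * n)) := by
  rcases hne.lt_or_gt with hlt | hlt
  · refine ⟨-1, ?_, by simpa using (h.conj.hasIndexAt_neg hn hlt).conj⟩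
    filter_upwards [h.conj.jacobian_pos hn hlt, h.eventually_hasWirtingerDerivAt] with z hJ hz
    rw [jacobian_conj hz.differentiableAt] at hJ
    simpa using hJ
  · exact ⟨1, by simpa using h.jacobian_pos hn hlt, by simpa using h.hasIndexAt_neg hn hlt⟩

end HasHarmonicPoleAt

theorem NonDegenerate.exists_sign_and_index {f : ℂ → ℂ} {S : Finset ℂ} (hf : NonDegenerate f S)
    {z₀ : ℂ} (hz₀ : z₀ ∈ S) : ∃ (σ : ℤˣ) (n : ℕ),
      (∀ᶠ z in 𝓝[≠] z₀, 0 < ((σ : ℤ) : ℝ) * jacobian f z) ∧ HasIndexAt f z₀ (-(σ * n)) := by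
  obtain ⟨n, H, G, c, hn, hH, hG, hne, heq⟩ := hf.pole_form z₀ hz₀
  obtain ⟨σ, h⟩ := HasHarmonicPoleAt.exists_sign_and_index ⟨hH, hG, heq⟩ hn hne
  exact ⟨σ, n, h⟩

theorem HasIndexAt.sub_const_of_tendsto_cobounded {f : ℂ → ℂ} {z : ℂ} {k : ℤ}
    (h : HasIndexAt f z k) (hf : Tendsto f (𝓝[≠] z) (Bornology.cobounded ℂ)) (η : ℂ) :
    HasIndexAt (fun w => f w - η) z k := by
  refine h.of_norm_sub_lt (h.eventually_continuousAt.mono fun w hw => hw.sub_const η) ?_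
  filter_upwards [(tendsto_norm_cobounded_atTop.comp hf).eventually_gt_atTop ‖η‖] with w hw
  rwa [sub_sub_cancel_left, norm_neg]

variable {f : ℂ → ℂ} {S : Finset ℂ} {A : Set ℂ}

theorem isOpen_notMem_finset (S : Finset ℂ) : IsOpen {z : ℂ | z ∉ S} :=
  S.finite_toSet.isClosed.isOpen_compl

theorem isPreconnected_notMem_finset (S : Finset ℂ) : IsPreconnected {z : ℂ | z ∉ S} :=
  (Set.Countable.isConnected_compl_of_one_lt_rank (E := ℂ) (by simp)
    S.finite_toSet.countable).isPreconnected

namespace NonDegenerate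

theorem differentiableAt (hf : NonDegenerate f S) {z : ℂ} (hz : z ∉ S) :
    DifferentiableAt ℝ f z :=
  (hf.harmonic z hz).1.differentiableAt two_ne_zero

theorem continuousAt (hf : NonDegenerate f S) {z : ℂ} (hz : z ∉ S) : ContinuousAt f z :=
  (hf.differentiableAt hz).continuousAt

theorem analyticOnNhd_dz (hf : NonDegenerate f S) : AnalyticOnNhd ℂ (dz f) {z | z ∉ S} :=
  fun z hz => analyticAt_dz (hf.harmonic z hz)

theorem analyticOnNhd_conj_dzbar (hf : NonDegenerate f S) :
    AnalyticOnNhd ℂ (fun z => (starRingEnd ℂ) (dzbar f z)) {z | z ∉ S} :=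
  fun z hz => analyticAt_conj_dzbar (hf.harmonic z hz)

theorem continuousAt_jacobian (hf : NonDegenerate f S) {z : ℂ} (hz : z ∉ S) :
    ContinuousAt (jacobian f) z := by
  have hk := (hf.analyticOnNhd_conj_dzbar z hz).continuousAt.norm
  simp only [norm_conj] at hk
  exact ((hf.analyticOnNhd_dz z hz).continuousAt.norm.pow 2).sub (hk.pow 2)

theorem eventually_sign (hf : NonDegenerate f S) {z : ℂ} (hz : z ∉ critSet f S) :
    ∃ σ : ℤˣ, ∀ᶠ w in 𝓝[≠] z, 0 < ((σ : ℤ) : ℝ) * jacobian f w := by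
  by_cases hzS : z ∈ S
  · obtain ⟨σ, -, hσ, -⟩ := hf.exists_sign_and_index hzS
    exact ⟨σ, hσ⟩
  have hJ := hf.continuousAt_jacobian hzS
  rcases lt_or_gt_of_ne fun h => hz ⟨hzS, h⟩ with h | h
  · refine ⟨-1, nhdsWithin_le_nhds ?_⟩
    filter_upwards [hJ.eventually_lt_const h] with w hw
    simpa using hw
  · refine ⟨1, nhdsWithin_le_nhds ?_⟩
    filter_upwards [hJ.eventually_const_lt h] with w hw
    simpa using hw

theorem isClosed_critSet (hf : NonDegenerate f S) : IsClosed (critSet f S) := by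
  rw [← isOpen_compl_iff, isOpen_iff_eventually]
  intro z hz
  obtain ⟨σ, hσ⟩ := hf.eventually_sign hz
  filter_upwards [eventually_nhdsWithin_iff.1 hσ] with w hw hwC
  obtain rfl | hwz := eq_or_ne w z
  · exact hz hwC
  · simpa [hwC.2] using hw hwz

theorem isCompact_critSet (hf : NonDegenerate f S) : IsCompact (critSet f S) := by
  refine Metric.isCompact_of_isClosed_isBounded hf.isClosed_critSet ?_
  rw [← Bornology.isCobounded_compl_iff, Bornology.isCobounded_def]
  filter_upwards [hf.sense_preserving_infty] with z hz hzC using hz.ne' hzC.2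

end NonDegenerate

/-- `f` preserves (`σ = 1`) or reverses (`σ = -1`) orientation on `A`. Punctured neighborhoods are
used because the Jacobian has no meaningful value at the poles of `f`. -/
def HasOrientation (f : ℂ → ℂ) (A : Set ℂ) (σ : ℤˣ) : Prop :=
  ∀ z ∈ A, ∀ᶠ w in 𝓝[≠] z, 0 < ((σ : ℤ) : ℝ) * jacobian f w

theorem eq_of_mul_pos {σ τ : ℤˣ} {x : ℝ} (hσ : 0 < ((σ : ℤ) : ℝ) * x)
    (hτ : 0 < ((τ : ℤ) : ℝ) * x) : σ = τ := by
  rcases Int.units_eq_one_or σ with rfl | rfl <;> rcases Int.units_eq_one_or τ with rfl | rfl <;>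
    first | rfl | (push_cast at hσ hτ; linarith)

theorem HasOrientation.eq_of_eventually {σ τ : ℤˣ} (hσ : HasOrientation f A σ) {z : ℂ}
    (hz : z ∈ A) (hτ : ∀ᶠ w in 𝓝[≠] z, 0 < ((τ : ℤ) : ℝ) * jacobian f w) : σ = τ := by
  obtain ⟨w, h₁, h₂⟩ := ((hσ z hz).and hτ).exists
  exact eq_of_mul_pos h₁ h₂

theorem isOpen_setOf_eventually_punctured (p : ℂ → Prop) : IsOpen {z | ∀ᶠ w in 𝓝[≠] z, p w} := by
  rw [isOpen_iff_eventually]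
  intro z hz
  filter_upwards [eventually_nhdsWithin_iff.1 (eventually_eventually_nhdsWithin.2 hz)] with y hy
  obtain rfl | hyz := eq_or_ne y z
  · exact hz
  · exact nhdsWithin_le_nhds (isOpen_compl_singleton.nhdsWithin_eq hyz ▸ hy hyz)

namespace IsTile

theorem isOpen (hf : NonDegenerate f S) (hA : IsTile f S A) : IsOpen A := by
  obtain ⟨z, -, rfl⟩ := hA
  exact hf.isClosed_critSet.isOpen_compl.connectedComponentIn

theorem isPreconnected (hA : IsTile f S A) : IsPreconnected A := by
  obtain ⟨z, -, rfl⟩ := hA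
  exact isPreconnected_connectedComponentIn

theorem notMem_critSet (hA : IsTile f S A) {z : ℂ} (hz : z ∈ A) : z ∉ critSet f S := by
  obtain ⟨w, -, rfl⟩ := hA
  exact connectedComponentIn_subset _ _ hz

theorem subset_of_inter_nonempty {B : Set ℂ} (hA : IsTile f S A) (hB : IsPreconnected B)
    (hBC : ∀ z ∈ B, z ∉ critSet f S) (hAB : (A ∩ B).Nonempty) : B ⊆ A := by
  obtain ⟨w, -, rfl⟩ := hA
  obtain ⟨z, hzA, hzB⟩ := hAB
  rw [connectedComponentIn_eq hzA]
  exact hB.subset_connectedComponentIn hzB hBC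

theorem frontier_subset (hf : NonDegenerate f S) (hA : IsTile f S A) :
    frontier A ⊆ critSet f S := by
  intro z hz
  by_contra hzC
  obtain ⟨r, hr, hball⟩ := Metric.isOpen_iff.1 hf.isClosed_critSet.isOpen_compl z hzC
  obtain ⟨w, hw, hwA⟩ := mem_closure_iff.1 (frontier_subset_closure hz) _ Metric.isOpen_ball
    (Metric.mem_ball_self hr)
  have hsub : Metric.ball z r ⊆ A := hA.subset_of_inter_nonempty
    (convex_ball z r).isPreconnected (fun w hw => hball hw) ⟨w, hwA, hw⟩
  rw [(hA.isOpen hf).frontier_eq] at hz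
  exact hz.2 (hsub (Metric.mem_ball_self hr))

theorem exists_hasOrientation (hf : NonDegenerate f S) (hA : IsTile f S A) :
    ∃ σ, HasOrientation f A σ := by
  let U (σ : ℤˣ) : Set ℂ := {z | ∀ᶠ w in 𝓝[≠] z, 0 < ((σ : ℤ) : ℝ) * jacobian f w}
  have hcover : A ⊆ U 1 ∪ U (-1) := by
    intro z hz
    obtain ⟨σ, hσ⟩ := hf.eventually_sign (hA.notMem_critSet hz)
    rcases Int.units_eq_one_or σ with rfl | rfl
    · exact Or.inl hσ
    · exact Or.inr hσ
  have hdisj : A ∩ (U 1 ∩ U (-1)) = ∅ := by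
    rw [eq_empty_iff_forall_notMem]
    rintro z ⟨-, h₁, h₂⟩
    rw [mem_ofPred_eq] at h₁ h₂
    obtain ⟨w, hw₁, hw₂⟩ := (h₁.and h₂).exists
    exact absurd (eq_of_mul_pos hw₁ hw₂) (by decide)
  rcases isPreconnected_iff_subset_of_disjoint.1 hA.isPreconnected _ _
    (isOpen_setOf_eventually_punctured _) (isOpen_setOf_eventually_punctured _) hcover hdisj
    with h | h
  · exact ⟨1, h⟩
  · exact ⟨-1, h⟩

theorem jacobian_pos (hf : NonDegenerate f S) (hA : IsTile f S A) {σ : ℤˣ}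
    (hσ : HasOrientation f A σ) {z : ℂ} (hz : z ∈ A) (hzS : z ∉ S) :
    0 < ((σ : ℤ) : ℝ) * jacobian f z := by
  have hnonneg : 0 ≤ ((σ : ℤ) : ℝ) * jacobian f z :=
    ge_of_tendsto (((hf.continuousAt_jacobian hzS).const_mul _).tendsto.mono_left
      nhdsWithin_le_nhds) ((hσ z hz).mono fun w hw => hw.le)
  refine hnonneg.lt_of_ne' (mul_ne_zero ?_ fun h => hA.notMem_critSet hz ⟨hzS, h⟩)
  exact_mod_cast σ.ne_zero

end IsTile

theorem finite_zeros_of_analyticOnNhd {F : ℂ → ℂ} {U K : Set ℂ} (hF : AnalyticOnNhd ℂ F U)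
    (hU : IsPreconnected U) (hK : IsCompact K) (hKU : K ⊆ U) (hne : ∃ z ∈ U, F z ≠ 0) :
    {z ∈ K | F z = 0}.Finite := by
  refine finite_of_eventually_notMem hK (sep_subset _ _) fun x hx => ?_
  by_contra hfreq
  rw [not_eventually] at hfreq
  obtain ⟨z, hz, hFz⟩ := hne
  exact hFz (hF.eqOn_zero_of_preconnected_of_frequently_eq_zero hU (hKU hx)
    (hfreq.mono fun w hw => (not_not.1 hw).2) hz)

theorem eqOn_const_mul_of_wronskian_eq_zero {h k : ℂ → ℂ} {U : Set ℂ} (hUo : IsOpen U)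
    (hU : IsPreconnected U) (hh : AnalyticOnNhd ℂ h U) (hk : AnalyticOnNhd ℂ k U)
    (hW : ∀ z ∈ U, deriv k z * h z - k z * deriv h z = 0) {z₁ : ℂ} (hz₁ : z₁ ∈ U)
    (hne : h z₁ ≠ 0) : EqOn k (fun z => k z₁ / h z₁ * h z) U := by
  refine hk.eqOn_of_preconnected_of_eventuallyEq (analyticOnNhd_const.mul hh) hU hz₁ ?_
  obtain ⟨r, hr, hball⟩ := Metric.eventually_nhds_iff_ball.1
    ((hUo.eventually_mem hz₁).and ((hh z₁ hz₁).continuousAt.eventually_ne hne))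
  have hderiv : ∀ w ∈ Metric.ball z₁ r, HasDerivAt (fun w => k w / h w) 0 w := by
    intro w hw
    obtain ⟨hwU, hw0⟩ := hball w hw
    simpa [hW w hwU] using (hk w hwU).differentiableAt.hasDerivAt.fun_div
      (hh w hwU).differentiableAt.hasDerivAt hw0
  filter_upwards [Metric.ball_mem_nhds z₁ hr] with w hw
  have hconst : k w / h w = k z₁ / h z₁ :=
    Metric.isOpen_ball.is_const_of_deriv_eq_zero (convex_ball z₁ r).isPreconnected
      (fun w hw => (hderiv w hw).differentiableAt.differentiableWithinAt)
      (fun w hw => (hderiv w hw).deriv) hw (Metric.mem_ball_self hr)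
  rw [← hconst, div_mul_cancel₀ _ (hball w hw).2]

namespace NonDegenerate

theorem dilatation_eq (hf : NonDegenerate f S) {z : ℂ} (hz : z ∉ S) (h0 : dz f z ≠ 0) :
    dilatation f z = (starRingEnd ℂ) (dzbar f z) / dz f z := by
  have ht : Tendsto (fun w => (starRingEnd ℂ) (dzbar f w) / dz f w) (𝓝[≠] z)
      (𝓝 ((starRingEnd ℂ) (dzbar f z) / dz f z)) :=
    ((hf.analyticOnNhd_conj_dzbar z hz).continuousAt.div (hf.analyticOnNhd_dz z hz).continuousAt
      h0).tendsto.mono_left nhdsWithin_le_nhds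
  have hex : ∃ w : ℂ, Tendsto (fun ζ => (starRingEnd ℂ) (dzbar f ζ) / dz f ζ) (𝓝[≠] z) (𝓝 w) :=
    ⟨_, ht⟩
  rw [dilatation, dif_pos hex]
  exact tendsto_nhds_unique hex.choose_spec ht

theorem jacobian_eq_mul (hf : NonDegenerate f S) {z : ℂ} (hz : z ∉ S) (h0 : dz f z ≠ 0) :
    jacobian f z = ‖dz f z‖ ^ 2 * (1 - ‖dilatation f z‖ ^ 2) := by
  have : ‖dz f z‖ ≠ 0 := norm_ne_zero_iff.2 h0
  rw [jacobian, hf.dilatation_eq hz h0, norm_div, norm_conj]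
  field_simp

theorem eventually_dz_ne_zero (hf : NonDegenerate f S) {z : ℂ} (hz : z ∉ S) (h0 : dz f z ≠ 0) :
    ∀ᶠ w in 𝓝 z, w ∉ S ∧ dz f w ≠ 0 :=
  ((isOpen_notMem_finset S).eventually_mem hz).and
    ((hf.analyticOnNhd_dz z hz).continuousAt.eventually_ne h0)

theorem eventuallyEq_dilatation (hf : NonDegenerate f S) {z : ℂ} (hz : z ∉ S)
    (h0 : dz f z ≠ 0) :
    dilatation f =ᶠ[𝓝 z] fun w => (starRingEnd ℂ) (dzbar f w) / dz f w :=
  (hf.eventually_dz_ne_zero hz h0).mono fun _ hw => hf.dilatation_eq hw.1 hw.2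

theorem analyticAt_dilatation (hf : NonDegenerate f S) {z : ℂ} (hz : z ∉ S) (h0 : dz f z ≠ 0) :
    AnalyticAt ℂ (dilatation f) z :=
  ((hf.analyticOnNhd_conj_dzbar z hz).div (hf.analyticOnNhd_dz z hz) h0).congr
    (hf.eventuallyEq_dilatation hz h0).symm

end NonDegenerate

/-- The critical points at which `𝒞` may fail to be an analytic arc parametrized by `arg ω`. -/
def singularSet (f : ℂ → ℂ) (S : Finset ℂ) : Set ℂ :=
  {z ∈ critSet f S | dz f z = 0 ∨ deriv (dilatation f) z = 0}

namespace NonDegenerate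

theorem exists_jacobian_pos (hf : NonDegenerate f S) : ∃ z ∉ S, 0 < jacobian f z :=
  (Eventually.and (Bornology.isBounded_def.1 S.finite_toSet.isBounded)
    hf.sense_preserving_infty).exists

theorem norm_dilatation_eq_one (hf : NonDegenerate f S) {z : ℂ} (hz : z ∈ critSet f S)
    (h0 : dz f z ≠ 0) : ‖dilatation f z‖ = 1 := by
  have hJ := hf.jacobian_eq_mul hz.1 h0
  rw [hz.2, zero_eq_mul, or_iff_right (pow_ne_zero 2 (norm_ne_zero_iff.2 h0)), sub_eq_zero] at hJ
  exact (pow_eq_one_iff_of_nonneg (norm_nonneg _) two_ne_zero).1 hJ.symm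

theorem finite_singularSet (hf : NonDegenerate f S) : (singularSet f S).Finite := by
  have hU := isPreconnected_notMem_finset S
  have hh := hf.analyticOnNhd_dz
  have hk := hf.analyticOnNhd_conj_dzbar
  have hCU : critSet f S ⊆ {z | z ∉ S} := fun z hz => hz.1
  obtain ⟨z₁, hz₁, hJ₁⟩ := hf.exists_jacobian_pos
  have hlt : ‖dzbar f z₁‖ < ‖dz f z₁‖ := lt_of_pow_lt_pow_left₀ 2 (norm_nonneg _) (sub_pos.1 hJ₁)
  have hne : dz f z₁ ≠ 0 := norm_pos_iff.1 ((norm_nonneg _).trans_lt hlt)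
  have hfin := finite_zeros_of_analyticOnNhd hh hU hf.isCompact_critSet hCU ⟨z₁, hz₁, hne⟩
  let W : ℂ → ℂ := fun z => deriv (fun w => (starRingEnd ℂ) (dzbar f w)) z * dz f z -
    (starRingEnd ℂ) (dzbar f z) * deriv (dz f) z
  by_cases hW : ∃ z ∈ {z | z ∉ S}, W z ≠ 0
  · have hWfin := finite_zeros_of_analyticOnNhd ((hk.deriv.mul hh).sub (hk.mul hh.deriv)) hU
      hf.isCompact_critSet hCU hW
    refine (hfin.union hWfin).subset fun z ⟨hz, hz'⟩ => ?_
    by_cases h0 : dz f z = 0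
    · exact Or.inl ⟨hz, h0⟩
    have hderiv := hz'.resolve_left h0
    rw [(hf.eventuallyEq_dilatation hz.1 h0).deriv_eq,
      ((hk z hz.1).differentiableAt.hasDerivAt.fun_div (hh z hz.1).differentiableAt.hasDerivAt
        h0).deriv, div_eq_zero_iff, or_iff_left (pow_ne_zero 2 h0)] at hderiv
    exact Or.inr ⟨hz, hderiv⟩
  · push Not at hW
    refine hfin.subset fun z ⟨hz, _⟩ => ⟨hz, ?_⟩
    -- `ω` is a constant of modulus `< 1`, so `J = |∂f/∂z|² (1 - |ω|²)` vanishes only with `∂f/∂z`.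
    have hprop : ‖dzbar f z‖ = ‖dzbar f z₁‖ / ‖dz f z₁‖ * ‖dz f z‖ := by
      simpa using congrArg norm (eqOn_const_mul_of_wronskian_eq_zero (isOpen_notMem_finset S) hU
        hh hk hW hz₁ hne hz.1)
    have hnorm : ‖dz f z‖ = ‖dzbar f z‖ :=
      (pow_left_inj₀ (norm_nonneg _) (norm_nonneg _) two_ne_zero).1 (sub_eq_zero.1 hz.2)
    have hquot : ‖dzbar f z₁‖ / ‖dz f z₁‖ < 1 := (div_lt_one (norm_pos_iff.2 hne)).2 hlt
    by_contra h0
    nlinarith [norm_pos_iff.2 h0]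

end NonDegenerate

theorem exists_nhds_isPreconnected_re_pos {ψ : ℂ → ℂ} {z d : ℂ} (hψ : HasStrictDerivAt ψ d z)
    (hd : d ≠ 0) {N : Set ℂ} (hN : N ∈ 𝓝 z) :
    ∃ V ∈ 𝓝 z, V ⊆ N ∧ IsPreconnected (V ∩ {w | 0 < (ψ w).re}) ∧
      ∀ w ∈ V, (ψ w).re = 0 → w ∈ closure (V ∩ {w | 0 < (ψ w).re}) := by
  have hF := hψ.hasStrictFDerivAt_equiv hd
  let e := hF.toOpenPartialHomeomorph ψ
  have hz : z ∈ e.source := hF.mem_toOpenPartialHomeomorph_source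
  have hmem : e.target ∩ e.symm ⁻¹' N ∈ 𝓝 (e z) :=
    inter_mem (e.open_target.mem_nhds (e.map_source hz))
      ((e.continuousAt_symm (e.map_source hz)).preimage_mem_nhds (by rwa [e.left_inv hz]))
  obtain ⟨ρ, hρ, hball⟩ := Metric.mem_nhds_iff.1 hmem
  let D : Set ℂ := Metric.ball (e z) ρ ∩ {v | 0 < v.re}
  have hside : e.source ∩ e ⁻¹' Metric.ball (e z) ρ ∩ {w | 0 < (ψ w).re} = e.symm '' D := by
    rw [e.symm_image_eq_source_inter_preimage fun v hv => (hball hv.1).1, inter_assoc]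
    rfl
  refine ⟨e.source ∩ e ⁻¹' Metric.ball (e z) ρ,
    (e.isOpen_inter_preimage Metric.isOpen_ball).mem_nhds ⟨hz, Metric.mem_ball_self hρ⟩,
    fun w hw => by simpa [e.left_inv hw.1] using (hball hw.2).2, ?_, fun w hw hwre => ?_⟩
  · rw [hside]
    exact ((convex_ball _ _).inter (convex_halfSpace_re_gt 0)).isPreconnected.image _
      (e.continuousOn_symm.mono fun v hv => (hball hv.1).1)
  · have hclosure : e w ∈ closure D := by
      refine Metric.isOpen_ball.inter_closure ⟨hw.2, ?_⟩
      rw [closure_setOfPred_lt_re]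
      exact hwre.ge
    rw [hside, ← e.left_inv hw.1]
    exact (e.continuousAt_symm (hball hw.2).1).continuousWithinAt.mem_closure_image hclosure

theorem exists_constant_of_locally_constant_off {Φ : ℂ → ℝ} {B E : Set ℂ} (hB : Dense Bᶜ)
    (hE : E.Countable) (hEB : E ⊆ B) (hΦ : ∀ z ∉ E, ∃ c, ∀ᶠ w in 𝓝 z, w ∉ B → Φ w = c) :
    ∃ c, ∀ z ∉ B, Φ z = c := by
  have hconn : IsConnected Eᶜ := hE.isConnected_compl_of_one_lt_rank (E := ℂ) (by simp)
  obtain ⟨z₁, hz₁⟩ := hconn.nonempty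
  obtain ⟨c, hc⟩ := hΦ z₁ hz₁
  have hopen (p : ℂ → Prop) : IsOpen {z | ∀ᶠ w in 𝓝 z, p w} :=
    isOpen_iff_eventually.2 fun z hz => eventually_eventually_nhds.2 hz
  have hsub : Eᶜ ⊆ {z | ∀ᶠ w in 𝓝 z, w ∉ B → Φ w = c} := by
    refine IsPreconnected.subset_left_of_subset_union
      (v := {z | ∀ᶠ w in 𝓝 z, w ∉ B → Φ w ≠ c}) (hopen _) (hopen _) ?_ (fun z hz => ?_)
      ⟨z₁, hz₁, hc⟩ hconn.isPreconnected
    · rw [disjoint_left]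
      intro z heq hne
      rw [mem_ofPred_eq] at heq hne
      obtain ⟨w, hw, hwB⟩ := mem_closure_iff_nhds.1 (hB z) _ (heq.and hne)
      exact hw.2 hwB (hw.1 hwB)
    · obtain ⟨c', hc'⟩ := hΦ z hz
      obtain rfl | hcc' := eq_or_ne c' c
      · exact Or.inl hc'
      · exact Or.inr (hc'.mono fun w hw hwB => by rwa [hw hwB])
  refine ⟨c, fun z hz => ?_⟩
  have hzc := hsub fun h => hz (hEB h)
  rw [mem_ofPred_eq] at hzc
  exact hzc.self_of_nhds hz

theorem dense_compl_frontier {X : Type*} [TopologicalSpace X] {s : Set X} (hs : IsOpen s) :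
    Dense (frontier s)ᶜ := by
  rw [← interior_eq_empty_iff_dense_compl, ← frontier_compl]
  exact interior_frontier hs.isClosed_compl

theorem eventually_indicator_eq {X M : Type*} [TopologicalSpace X] [Zero M] {s : Set X} {x : X}
    (hx : x ∉ frontier s) (m : M) :
    ∀ᶠ y in 𝓝 x, s.indicator (fun _ => m) y = s.indicator (fun _ => m) x := by
  by_cases hxs : x ∈ closure s
  · have hxi : x ∈ interior s := by_contra fun h => hx ⟨hxs, h⟩
    filter_upwards [isOpen_interior.mem_nhds hxi] with y hy
    rw [indicator_of_mem (interior_subset hy), indicator_of_mem (interior_subset hxi)]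
  · filter_upwards [isClosed_closure.isOpen_compl.mem_nhds hxs] with y hy
    rw [indicator_of_notMem fun h => hy (subset_closure h),
      indicator_of_notMem fun h => hxs (subset_closure h)]

section Arc

variable {z : ℂ}

theorem NonDegenerate.eventually_jacobian_sign (hf : NonDegenerate f S)
    (hz : z ∉ S) (h0 : dz f z ≠ 0) :
    ∀ᶠ w in 𝓝 z, SignType.sign (jacobian f w) = SignType.sign (1 - ‖dilatation f w‖) := by
  filter_upwards [hf.eventually_dz_ne_zero hz h0] with w hw
  have hdz : 0 < ‖dz f w‖ := norm_pos_iff.2 hw.2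
  have hfactor : jacobian f w =
      ‖dz f w‖ ^ 2 * (1 + ‖dilatation f w‖) * (1 - ‖dilatation f w‖) := by
    rw [hf.jacobian_eq_mul hw.1 hw.2]
    ring
  rw [hfactor, sign_mul, sign_pos (by positivity), one_mul]

theorem sign_one_sub_eq_sign_neg_log {x : ℝ} (hx : 0 < x) :
    SignType.sign (1 - x) = SignType.sign (-Real.log x) := by
  obtain hlt | rfl | hgt := lt_trichotomy x 1
  · rw [sign_pos (sub_pos.2 hlt), sign_pos (neg_pos.2 (Real.log_neg hx hlt))]
  · simp
  · rw [sign_neg (sub_neg.2 hgt), sign_neg (neg_lt_zero.2 (Real.log_pos hgt))]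

/-- One may take `ψ = -σ log (ω / ω z)`, whose real part is `-σ log |ω|`. -/
theorem NonDegenerate.exists_hasStrictDerivAt_sign_re_eq (hf : NonDegenerate f S) (σ : ℤˣ)
    (hz : z ∈ critSet f S) (h0 : dz f z ≠ 0) (hd : deriv (dilatation f) z ≠ 0) :
    ∃ (ψ : ℂ → ℂ) (d : ℂ), d ≠ 0 ∧ HasStrictDerivAt ψ d z ∧ ∀ᶠ w in 𝓝 z, w ∉ S ∧
      SignType.sign (ψ w).re = SignType.sign (((σ : ℤ) : ℝ) * jacobian f w) := by
  have hω := hf.analyticAt_dilatation hz.1 h0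
  have hω1 := hf.norm_dilatation_eq_one hz h0
  have hωz : dilatation f z ≠ 0 := norm_ne_zero_iff.1 (by rw [hω1]; exact one_ne_zero)
  have hσ : -((σ : ℤ) : ℂ) ≠ 0 := neg_ne_zero.2 (by exact_mod_cast σ.ne_zero)
  have hlog : HasStrictDerivAt (fun w => log (dilatation f w / dilatation f z))
      (deriv (dilatation f) z / dilatation f z) z := by
    have hquot := (hω.hasStrictDerivAt.div_const (dilatation f z)).clog
      (by rw [div_self hωz]; exact one_mem_slitPlane)
    rwa [div_self hωz, div_one] at hquot
  refine ⟨_, _, mul_ne_zero hσ (div_ne_zero hd hωz), hlog.const_mul _, ?_⟩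
  filter_upwards [hf.eventually_jacobian_sign hz.1 h0, hω.continuousAt.eventually_ne hωz,
    (isOpen_notMem_finset S).eventually_mem hz.1] with w hw hw0 hwS
  have hre : (-((σ : ℤ) : ℂ) * log (dilatation f w / dilatation f z)).re =
      ((σ : ℤ) : ℝ) * -Real.log ‖dilatation f w‖ := by
    simp [log_re, hω1]
  rw [hre, sign_mul, sign_mul, hw, sign_one_sub_eq_sign_neg_log (norm_pos_iff.2 hw0)]
  exact ⟨hwS, rfl⟩

theorem IsTile.eventually_mem_iff_jacobian_pos (hf : NonDegenerate f S) (hA : IsTile f S A)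
    {σ : ℤˣ} (hσ : HasOrientation f A σ) (hz : z ∈ frontier A) (hzs : z ∉ singularSet f S) :
    ∀ᶠ w in 𝓝 z, w ∉ frontier A →
      jacobian f w ≠ 0 ∧ (w ∈ A ↔ 0 < ((σ : ℤ) : ℝ) * jacobian f w) := by
  have hzC := hA.frontier_subset hf hz
  obtain ⟨ψ, d, hd, hψ, hψre⟩ := hf.exists_hasStrictDerivAt_sign_re_eq σ hzC
    (fun h => hzs ⟨hzC, Or.inl h⟩) (fun h => hzs ⟨hzC, Or.inr h⟩)
  obtain ⟨V, hV, hVN, hconn, hclosure⟩ := exists_nhds_isPreconnected_re_pos hψ hd hψre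
  have hpos {w : ℂ} (hw : w ∈ V) : 0 < (ψ w).re ↔ 0 < ((σ : ℤ) : ℝ) * jacobian f w := by
    rw [← sign_eq_one_iff, (hVN hw).2, sign_eq_one_iff]
  obtain ⟨y, hyV, hyA⟩ := mem_closure_iff_nhds.1 hz.1 V hV
  have hside : V ∩ {w | 0 < (ψ w).re} ⊆ A :=
    hA.subset_of_inter_nonempty hconn
      (fun w hw hwC => ((hpos hw.1).1 hw.2).ne' (by rw [hwC.2, mul_zero]))
      ⟨y, hyA, hyV, (hpos hyV).2 (hA.jacobian_pos hf hσ hyA (hVN hyV).1)⟩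
  filter_upwards [hV] with w hw hwA
  have hmem : w ∈ A ↔ 0 < ((σ : ℤ) : ℝ) * jacobian f w :=
    ⟨fun h => hA.jacobian_pos hf hσ h (hVN hw).1, fun h => hside ⟨hw, (hpos hw).2 h⟩⟩
  refine ⟨fun hJ => hwA ⟨?_, ?_⟩, hmem⟩
  · refine closure_mono hside (hclosure w hw ?_)
    rw [← sign_eq_zero_iff, (hVN hw).2, hJ, mul_zero, sign_zero]
  · rw [(hA.isOpen hf).interior_eq, hmem, hJ, mul_zero]
    exact lt_irrefl 0

end Arc

namespace IsCritParam

variable {σ : ℤˣ} {n : ℕ} {a b : Fin n → ℝ} {γ : Fin n → ℝ → ℂ}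

theorem exists_sum_windingNumber_sub_indicator_eq_near (hf : NonDegenerate f S)
    (hA : IsTile f S A) (hσ : HasOrientation f A σ)
    (hγ : IsCritParam f (frontier A \ exceptSet f S) a b γ) {z : ℂ} (hz : z ∈ frontier A)
    (hzs : z ∉ singularSet f S) (hza : ∀ j, γ j (a j) ≠ z) :
    ∃ c : ℝ, ∀ᶠ w in 𝓝 z, w ∉ frontier A →
      ∑ j, windingNumber (γ j) (a j) (b j) w - A.indicator (fun _ => ((σ : ℤ) : ℝ)) w = c := by
  have hzC := hA.frontier_subset hf hz
  have h0 : dz f z ≠ 0 := fun h => hzs ⟨hzC, Or.inl h⟩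
  have hω1 := hf.norm_dilatation_eq_one hzC h0
  obtain ⟨m, hm⟩ := hγ.exists_sum_windingNumber_jump ⟨hz, fun h => h.2 hω1⟩
    (hf.analyticAt_dilatation hzC.1 h0) (fun h => hzs ⟨hzC, Or.inr h⟩) hza
  refine ⟨if σ = 1 then m else m + 1, ?_⟩
  filter_upwards [hm, hf.eventually_jacobian_sign hzC.1 h0,
    hA.eventually_mem_iff_jacobian_pos hf hσ hz hzs] with w hjump hsign hside hw
  obtain ⟨hJ0, hmem⟩ := hside hw
  have hneg : jacobian f w < 0 ↔ 1 < ‖dilatation f w‖ := by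
    rw [← sign_eq_neg_one_iff, hsign, sign_eq_neg_one_iff, sub_neg]
  have hpos : 0 < jacobian f w ↔ ‖dilatation f w‖ < 1 := by
    rw [← sign_eq_one_iff, hsign, sign_eq_one_iff, sub_pos]
  obtain rfl | rfl := Int.units_eq_one_or σ <;> obtain hJ | hJ := hJ0.lt_or_gt <;>
    simp [indicator, hmem, hJ, hJ.not_gt, hjump.1, hjump.2, hneg.1, hpos.1]

theorem exists_sum_windingNumber_eq (hf : NonDegenerate f S) (hA : IsTile f S A)
    (hσ : HasOrientation f A σ) (hγ : IsCritParam f (frontier A \ exceptSet f S) a b γ) :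
    ∃ c : ℝ, ∀ p ∉ frontier A, ∑ j, windingNumber (γ j) (a j) (b j) p =
      A.indicator (fun _ => ((σ : ℤ) : ℝ)) p + c := by
  let E : Set ℂ := (singularSet f S ∪ range fun j => γ j (a j)) ∩ frontier A
  have hE : E.Finite := (hf.finite_singularSet.union (finite_range _)).subset inter_subset_left
  obtain ⟨c, hc⟩ := exists_constant_of_locally_constant_off
    (Φ := fun p => ∑ j, windingNumber (γ j) (a j) (b j) p -
      A.indicator (fun _ => ((σ : ℤ) : ℝ)) p)
    (dense_compl_frontier (hA.isOpen hf)) hE.countable inter_subset_right fun z hz => by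
      by_cases hzA : z ∈ frontier A
      · exact hγ.exists_sum_windingNumber_sub_indicator_eq_near hf hA hσ hzA
          (fun h => hz ⟨Or.inl h, hzA⟩) fun j h => hz ⟨Or.inr ⟨j, h⟩, hzA⟩
      · refine ⟨∑ j, windingNumber (γ j) (a j) (b j) z -
          A.indicator (fun _ => ((σ : ℤ) : ℝ)) z, ?_⟩
        filter_upwards [hγ.eventually_sum_windingNumber_eq fun h => hzA h.1,
          eventually_indicator_eq hzA ((σ : ℤ) : ℝ)] with w hw hwA _
        rw [hw, hwA]
  exact ⟨c, fun p hp => by rw [← hc p hp, add_sub_cancel]⟩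

end IsCritParam

variable {σ : ℤˣ} {η : ℂ}

theorem HasOrientation.hasIndexAt_preimage (hf : NonDegenerate f S) (hA : IsTile f S A)
    (hσ : HasOrientation f A σ) {z : ℂ} (hz : z ∈ preimages f S A η) :
    HasIndexAt (fun w => f w - η) z σ := by
  obtain ⟨hzA, hzS, hzη⟩ := hz
  refine hasIndexAt_of_jacobian (sub_eq_zero.2 hzη) ((hf.differentiableAt hzS).sub_const η) ?_ ?_
  · filter_upwards [(isOpen_notMem_finset S).eventually_mem hzS] with w hw
    exact (hf.continuousAt hw).sub_const η
  · rw [jacobian_sub_const]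
    exact hA.jacobian_pos hf hσ hzA hzS

theorem HasOrientation.exists_hasIndexAt_pole (hf : NonDegenerate f S)
    (hσ : HasOrientation f A σ) {z : ℂ} (hzA : z ∈ A) (hzS : z ∈ S) (η : ℂ) :
    ∃ k : ℤ, HasIndexAt (fun w => f w - η) z k ∧
      (k : ℝ) = -(((σ : ℤ) : ℝ) * |poincareIndex f z|) := by
  obtain ⟨τ, n, hτ, hindex⟩ := hf.exists_sign_and_index hzS
  obtain rfl := hσ.eq_of_eventually hzA hτ
  refine ⟨_, hindex.sub_const_of_tendsto_cobounded (hf.pole z hzS) η, ?_⟩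
  obtain rfl | rfl := Int.units_eq_one_or σ <;> simp [hindex.poincareIndex_eq]

theorem IsTile.eventually_ne (hf : NonDegenerate f S) (hA : IsTile f S A)
    (hη : ∀ z ∈ frontier A, f z ≠ η) {z : ℂ} (hz : z ∈ closure A) :
    ∀ᶠ w in 𝓝[≠] z, f w ≠ η := by
  obtain ⟨σ, hσ⟩ := hA.exists_hasOrientation hf
  by_cases hzS : z ∈ S
  · filter_upwards [(tendsto_norm_cobounded_atTop.comp (hf.pole z hzS)).eventually_gt_atTop ‖η‖]
      with w hw hwη
    exact hw.ne' (congrArg norm hwη)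
  by_cases hzη : f z = η
  · have hzA : z ∈ A := by
      by_contra h
      exact hη z ((hA.isOpen hf).frontier_eq ▸ ⟨hz, h⟩) hzη
    exact (hσ.hasIndexAt_preimage hf hA ⟨hzA, hzS, hzη⟩).eventually_ne_zero.mono
      fun w hw => sub_ne_zero.1 hw
  · exact ((hf.continuousAt hzS).eventually_ne hzη).filter_mono nhdsWithin_le_nhds

theorem IsTile.finite_preimages (hf : NonDegenerate f S) (hA : IsTile f S A)
    (hη : ∀ z ∈ frontier A, f z ≠ η) (hb : Bornology.IsBounded (preimages f S A η)) :
    (preimages f S A η).Finite :=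
  finite_of_eventually_notMem hb.isCompact_closure subset_closure fun _ hx =>
    (hA.eventually_ne hf hη (closure_mono (fun _ hz => hz.1) hx)).mono fun _ hw hwp => hw hwp.2.2

theorem HasOrientation.exists_hasIndexAt_sum_eq (hf : NonDegenerate f S) (hA : IsTile f S A)
    (hσ : HasOrientation f A σ) (hfin : (preimages f S A η).Finite) :
    ∃ (Q : Finset ℂ) (k : ℂ → ℤ), (∀ z, z ∈ Q ↔ z ∈ A ∧ (z ∈ S ∨ f z = η)) ∧
      (∀ z ∈ Q, HasIndexAt (fun w => f w - η) z (k z)) ∧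
      ∑ z ∈ Q, (k z : ℝ) = ((σ : ℤ) : ℝ) * ((preimages f S A η).ncard - poleCount f S A) := by
  classical
  have hindex (z : ℂ) : ∃ k : ℤ,
      (z ∈ preimages f S A η → HasIndexAt (fun w => f w - η) z k ∧ k = σ) ∧
      (z ∈ S → z ∈ A → HasIndexAt (fun w => f w - η) z k ∧
        (k : ℝ) = -(((σ : ℤ) : ℝ) * |poincareIndex f z|)) := by
    by_cases hz : z ∈ S ∧ z ∈ A
    · obtain ⟨k, hk⟩ := hσ.exists_hasIndexAt_pole hf hz.2 hz.1 η
      exact ⟨k, fun h => absurd hz.1 h.2.1, fun _ _ => hk⟩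
    · exact ⟨σ, fun h => ⟨hσ.hasIndexAt_preimage hf hA h, rfl⟩, fun hS hA => (hz ⟨hS, hA⟩).elim⟩
  choose k hpre hpole using hindex
  refine ⟨hfin.toFinset ∪ {z ∈ S | z ∈ A}, k, fun z => ?_, fun z hz => ?_, ?_⟩
  · simp only [Finset.mem_union, Finite.mem_toFinset, Finset.mem_filter, preimages, mem_ofPred_eq]
    tauto
  · obtain hz | hz := Finset.mem_union.1 hz
    · exact (hpre z (hfin.mem_toFinset.1 hz)).1
    · exact (hpole z (Finset.mem_filter.1 hz).1 (Finset.mem_filter.1 hz).2).1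
  · have hdisj : Disjoint hfin.toFinset {z ∈ S | z ∈ A} := Finset.disjoint_left.2 fun z hz hzS =>
      (hfin.mem_toFinset.1 hz).2.1 (Finset.mem_filter.1 hzS).1
    have hsum_pre : ∑ z ∈ hfin.toFinset, (k z : ℝ) =
        (preimages f S A η).ncard * ((σ : ℤ) : ℝ) := by
      rw [ncard_eq_toFinset_card _ hfin, ← nsmul_eq_mul]
      exact Finset.sum_eq_card_nsmul fun z hz => by rw [(hpre z (hfin.mem_toFinset.1 hz)).2]
    have hsum_pole : ∑ z ∈ S with z ∈ A, (k z : ℝ) = -(((σ : ℤ) : ℝ) * poleCount f S A) := by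
      rw [poleCount, Finset.mul_sum, ← Finset.sum_neg_distrib]
      exact Finset.sum_congr rfl fun z hz =>
        (hpole z (Finset.mem_filter.1 hz).1 (Finset.mem_filter.1 hz).2).2
    rw [Finset.sum_union hdisj, hsum_pre, hsum_pole]
    ring

theorem HasOrientation.sum_windingNumber_comp_eq (hf : NonDegenerate f S) (hA : IsTile f S A)
    (hσ : HasOrientation f A σ) (hη : ∀ z ∈ frontier A, f z ≠ η)
    (hfin : (preimages f S A η).Finite) {ι : Type*} [Fintype ι] {c : ι → ℝ → ℂ} {a b : ι → ℝ}
    {K : Set ℂ} (hK : IsCompact K) (hKA : K ⊆ closure A)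
    (hc : ∀ i, IsClosedCurve (c i) (a i) (b i))
    (hcK : ∀ i, MapsTo (c i) (Icc (a i) (b i)) {z ∈ K | z ∉ S ∧ f z ≠ η})
    (hnull : ∀ p ∉ K, ∑ i, windingNumber (c i) (a i) (b i) p = 0)
    (hwn : ∀ p ∈ A, p ∈ S ∨ f p = η →
      ∑ i, windingNumber (c i) (a i) (b i) p = ((σ : ℤ) : ℝ)) :
    ∑ i, windingNumber (fun t => f (c i t)) (a i) (b i) η =
      (preimages f S A η).ncard - poleCount f S A := by
  obtain ⟨Q, k, hQ, hk, hsum⟩ := hσ.exists_hasIndexAt_sum_eq hf hA hfin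
  have hKQ : ∀ z ∈ K \ ↑Q, z ∉ S ∧ f z ≠ η := by
    rintro z ⟨hzK, hzQ⟩
    by_cases hzA : z ∈ A
    · simpa [hQ, hzA] using hzQ
    · have hz : z ∈ frontier A := (hA.isOpen hf).frontier_eq ▸ ⟨hKA hzK, hzA⟩
      exact ⟨(hA.frontier_subset hf hz).1, hη z hz⟩
  have hg : ContinuousOn (fun w => f w - η) (K \ Q) := fun z hz =>
    (hf.continuousAt (hKQ z hz).1).continuousWithinAt.sub_const η
  have hprinciple := sum_winding_comp_eq_sum hK hc
    (fun i t ht => ⟨(hcK i ht).1, fun h => ((hQ _).1 h).2.elim (hcK i ht).2.1 (hcK i ht).2.2⟩)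
    hnull hg (fun z hz => sub_ne_zero.2 (hKQ z hz).2) hk
  have hσσ : ((σ : ℤ) : ℝ) * ((σ : ℤ) : ℝ) = 1 := by
    rw [← Int.cast_mul, ← Units.val_mul, Int.units_mul_self, Units.val_one, Int.cast_one]
  calc ∑ i, windingNumber (fun t => f (c i t)) (a i) (b i) η
      = ∑ z ∈ Q, k z * ∑ i, windingNumber (c i) (a i) (b i) z := hprinciple
    _ = (∑ z ∈ Q, (k z : ℝ)) * ((σ : ℤ) : ℝ) := by
      rw [Finset.sum_mul]
      exact Finset.sum_congr rfl fun z hz => by rw [hwn z ((hQ z).1 hz).1 ((hQ z).1 hz).2]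
    _ = (preimages f S A η).ncard - poleCount f S A := by
      rw [hsum, mul_right_comm, hσσ, one_mul]

theorem isPreconnected_norm_gt {R : ℝ} (hR : 0 < R) : IsPreconnected {z : ℂ | R < ‖z‖} := by
  have himage : {z : ℂ | R < ‖z‖} = exp '' {w | Real.log R < w.re} := by
    ext z
    refine ⟨fun hz => ⟨log z, ?_, exp_log (norm_pos_iff.1 (hR.trans hz))⟩, ?_⟩
    · rw [mem_ofPred_eq, log_re]
      exact Real.log_lt_log hR hz
    · rintro ⟨w, hw, rfl⟩
      rw [mem_ofPred_eq, norm_exp]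
      exact (Real.log_lt_iff_lt_exp hR).1 hw
  rw [himage]
  exact (convex_halfSpace_re_gt _).isPreconnected.image _ continuous_exp.continuousOn

theorem exists_pos_forall_lt_norm {p : ℂ → Prop} (hp : ∀ᶠ z in Bornology.cobounded ℂ, p z) :
    ∃ R > 0, ∀ z, R < ‖z‖ → p z := by
  rw [← comap_norm_atTop, eventually_comap] at hp
  obtain ⟨R, hR⟩ := eventually_atTop.1 hp
  exact ⟨max R 1, by positivity, fun z hz => hR ‖z‖ ((le_max_left _ _).trans hz.le) z rfl⟩

namespace IsTile

theorem notMem_frontier (hf : NonDegenerate f S) (hA : IsTile f S A) {p : ℂ} (hp : p ∈ A) :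
    p ∉ frontier A :=
  fun h => disjoint_left.1 (disjoint_frontier_iff_isOpen.2 (hA.isOpen hf)) h hp

theorem eventually_mem (hf : NonDegenerate f S) (hA : IsTile f S A)
    (hb : ¬ Bornology.IsBounded A) : ∀ᶠ z in Bornology.cobounded ℂ, z ∈ A := by
  obtain ⟨R, hR, hJ⟩ := exists_pos_forall_lt_norm hf.sense_preserving_infty
  have hsub : {z : ℂ | R < ‖z‖} ⊆ A := by
    refine hA.subset_of_inter_nonempty (isPreconnected_norm_gt hR)
      (fun z hz hzC => (hJ z hz).ne' hzC.2) ?_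
    contrapose! hb
    refine (Metric.isBounded_closedBall (x := (0 : ℂ)) (r := R)).subset fun z hz => ?_
    rw [mem_closedBall_zero_iff]
    exact not_lt.1 fun h => hb.subset ⟨hz, h⟩
  exact (tendsto_norm_cobounded_atTop.eventually_gt_atTop R).mono hsub

theorem hasOrientation_one (hf : NonDegenerate f S) (hA : IsTile f S A)
    (hb : ¬ Bornology.IsBounded A) : HasOrientation f A 1 := by
  obtain ⟨σ, hσ⟩ := hA.exists_hasOrientation hf
  have hS : ∀ᶠ z in Bornology.cobounded ℂ, z ∉ S :=
    Bornology.isBounded_def.1 S.finite_toSet.isBounded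
  obtain ⟨z, ⟨hzA, hzS⟩, hJ⟩ :=
    (((hA.eventually_mem hf hb).and hS).and hf.sense_preserving_infty).exists
  rwa [← eq_of_mul_pos (hA.jacobian_pos hf hσ hzA hzS) (τ := 1) (by simpa using hJ)]

end IsTile

section Count

variable {n : ℕ} {a b : Fin n → ℝ} {γ : Fin n → ℝ → ℂ}

namespace IsCritParam

theorem sum_windingNumber_eq_of_isBounded (hf : NonDegenerate f S) (hA : IsTile f S A)
    (hσ : HasOrientation f A σ) (hγ : IsCritParam f (frontier A \ exceptSet f S) a b γ)
    (hb : Bornology.IsBounded A) {p : ℂ} (hp : p ∉ frontier A) :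
    ∑ j, windingNumber (γ j) (a j) (b j) p = A.indicator (fun _ => ((σ : ℤ) : ℝ)) p := by
  obtain ⟨c, hc⟩ := hγ.exists_sum_windingNumber_eq hf hA hσ
  have hfar : ∀ᶠ q in Bornology.cobounded ℂ, q ∉ closure A :=
    Bornology.isBounded_def.1 hb.closure
  obtain ⟨q, hqA, hq0⟩ := (hfar.and hγ.eventually_sum_windingNumber_eq_zero).exists
  have hcq := hc q fun h => hqA (frontier_subset_closure h)
  rw [hq0, indicator_of_notMem fun h => hqA (subset_closure h), zero_add] at hcq
  rw [hc p hp, ← hcq, add_zero]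

theorem sum_windingNumber_eq_of_not_isBounded (hf : NonDegenerate f S) (hA : IsTile f S A)
    (hγ : IsCritParam f (frontier A \ exceptSet f S) a b γ) (hb : ¬ Bornology.IsBounded A)
    {p : ℂ} (hp : p ∉ frontier A) :
    ∑ j, windingNumber (γ j) (a j) (b j) p = A.indicator (fun _ => 1) p - 1 := by
  obtain ⟨c, hc⟩ := hγ.exists_sum_windingNumber_eq hf hA (hA.hasOrientation_one hf hb)
  obtain ⟨q, hqA, hq0⟩ := ((hA.eventually_mem hf hb).and
    hγ.eventually_sum_windingNumber_eq_zero).exists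
  have hcq := hc q (hA.notMem_frontier hf hqA)
  rw [hq0, indicator_of_mem hqA, Units.val_one, Int.cast_one] at hcq
  rw [hc p hp, Units.val_one, Int.cast_one, sub_eq_add_neg, eq_neg_of_add_eq_zero_right hcq.symm]

theorem windingNumber_circleMap_add_sum_eq_indicator (hf : NonDegenerate f S)
    (hA : IsTile f S A) (hγ : IsCritParam f (frontier A \ exceptSet f S) a b γ)
    (hb : ¬ Bornology.IsBounded A) {R : ℝ} (hR : 0 ≤ R) (hfar : ∀ z, R ≤ ‖z‖ → z ∈ A) {p : ℂ}
    (hp : p ∉ frontier A) (hpR : ‖p‖ ≠ R) (s : ℝ) :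
    windingNumber (circleMap 0 R) s (s + 2 * Real.pi) p +
      ∑ j, windingNumber (γ j) (a j) (b j) p = (A ∩ Metric.ball 0 R).indicator (fun _ => 1) p := by
  rw [hγ.sum_windingNumber_eq_of_not_isBounded hf hA hb hp, inter_comm, ← indicator_indicator]
  obtain hlt | hgt := hpR.lt_or_gt
  · rw [windingNumber_circleMap_of_lt (by rwa [sub_zero]),
      indicator_of_mem (mem_ball_zero_iff.2 hlt), add_sub_cancel]
  · rw [windingNumber_circleMap_of_gt hR (by rwa [sub_zero]), indicator_of_mem (hfar p hgt.le),
      indicator_of_notMem fun h => hgt.not_gt (mem_ball_zero_iff.1 h), sub_self, add_zero]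

end IsCritParam

namespace IsTile

theorem sum_windingNumber_eq_of_isBounded (hf : NonDegenerate f S) (hA : IsTile f S A)
    (hη : ∀ z ∈ frontier A, f z ≠ η) (hγ : IsCritParam f (frontier A \ exceptSet f S) a b γ)
    (hb : Bornology.IsBounded A) (hfin : (preimages f S A η).Finite) :
    ∑ j, windingNumber (fun t => f (γ j t)) (a j) (b j) η =
      (preimages f S A η).ncard - poleCount f S A := by
  obtain ⟨σ, hσ⟩ := hA.exists_hasOrientation hf
  have hwn (p : ℂ) := hγ.sum_windingNumber_eq_of_isBounded hf hA hσ hb (p := p)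
  refine hσ.sum_windingNumber_comp_eq hf hA hη hfin hb.isCompact_closure subset_rfl
    hγ.isClosedCurve (fun j t ht => ?_) (fun p hp => ?_) fun p hp _ => ?_
  · have hfr := (hγ.mem ht).1
    exact ⟨frontier_subset_closure hfr, (hA.frontier_subset hf hfr).1, hη _ hfr⟩
  · rw [hwn p fun h => hp (frontier_subset_closure h),
      indicator_of_notMem fun h => hp (subset_closure h)]
  · rw [hwn p (hA.notMem_frontier hf hp), indicator_of_mem hp]

/-- On `closure A ∩ closedBall 0 R` the argument principle applies to the critical curves together
with the circle of radius `R`. -/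
theorem windingNumber_circleMap_add_sum_eq (hf : NonDegenerate f S) (hA : IsTile f S A)
    (hη : ∀ z ∈ frontier A, f z ≠ η) (hγ : IsCritParam f (frontier A \ exceptSet f S) a b γ)
    (hb : ¬ Bornology.IsBounded A) (hfin : (preimages f S A η).Finite) {R : ℝ} (hR : 0 < R)
    (hfar : ∀ z, R ≤ ‖z‖ → z ∈ A ∧ z ∉ S ∧ f z ≠ η) (s : ℝ) :
    windingNumber (fun t => f (circleMap 0 R t)) s (s + 2 * Real.pi) η +
      ∑ j, windingNumber (fun t => f (γ j t)) (a j) (b j) η =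
      (preimages f S A η).ncard - poleCount f S A := by
  have hlt {z : ℂ} (hz : ¬(z ∈ A ∧ z ∉ S ∧ f z ≠ η)) : ‖z‖ < R :=
    not_le.1 fun hle => hz (hfar z hle)
  have hnorm (t : ℝ) : ‖circleMap 0 R t‖ = R := by rw [norm_circleMap_zero, abs_of_pos hR]
  have hfrontier {z : ℂ} (hz : z ∈ frontier A) : ‖z‖ < R :=
    hlt fun h => hA.notMem_frontier hf h.1 hz
  have hwn {p : ℂ} (hp : p ∉ frontier A) (hpR : ‖p‖ ≠ R) :=
    hγ.windingNumber_circleMap_add_sum_eq_indicator hf hA hb hR.le (fun z hz => (hfar z hz).1)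
      hp hpR s
  have hcount := (hA.hasOrientation_one hf hb).sum_windingNumber_comp_eq hf hA hη hfin
    (c := fun i : Option (Fin n) => i.elim (circleMap 0 R) γ) (a := fun i => i.elim s a)
    (b := fun i => i.elim (s + 2 * Real.pi) b)
    ((isCompact_closedBall (0 : ℂ) R).inter_left isClosed_closure) inter_subset_left
    (Option.forall.2 ⟨isClosedCurve_circleMap 0 R s, hγ.isClosedCurve⟩)
    (Option.forall.2 ⟨fun t _ => ?_, fun j t ht => ?_⟩) (fun p hp => ?_) fun p hp hpη => ?_
  · simpa only [Fintype.sum_option, Option.elim_none, Option.elim_some] using hcount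
  · have hmem := hfar (circleMap 0 R t) (hnorm t).ge
    exact ⟨⟨subset_closure hmem.1, mem_closedBall_zero_iff.2 (hnorm t).le⟩, hmem.2⟩
  · have hfr := (hγ.mem ht).1
    exact ⟨⟨frontier_subset_closure hfr, mem_closedBall_zero_iff.2 (hfrontier hfr).le⟩,
      (hA.frontier_subset hf hfr).1, hη _ hfr⟩
  · rw [mem_inter_iff, mem_closedBall_zero_iff] at hp
    have hpR : ‖p‖ ≠ R := fun h => hp ⟨subset_closure (hfar p h.ge).1, h.le⟩
    rw [Fintype.sum_option]
    refine (hwn (fun h => hp ⟨frontier_subset_closure h, (hfrontier h).le⟩) hpR).trans ?_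
    exact indicator_of_notMem
      (fun h => hp ⟨subset_closure h.1, (mem_ball_zero_iff.1 h.2).le⟩) _
  · have hpR := hlt fun h => hpη.elim h.2.1 h.2.2
    rw [Fintype.sum_option, Units.val_one, Int.cast_one]
    refine (hwn (hA.notMem_frontier hf hp) hpR.ne).trans ?_
    exact indicator_of_mem (mem_inter hp (mem_ball_zero_iff.2 hpR)) _

theorem sum_windingNumber_sub_poincareIndexInfty_eq (hf : NonDegenerate f S) (hA : IsTile f S A)
    (hη : ∀ z ∈ frontier A, f z ≠ η) (hγ : IsCritParam f (frontier A \ exceptSet f S) a b γ)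
    (hb : ¬ Bornology.IsBounded A) (hinf : ∀ᶠ z in Bornology.cobounded ℂ, f z ≠ η)
    (hfin : (preimages f S A η).Finite) :
    ∑ j, windingNumber (fun t => f (γ j t)) (a j) (b j) η -
        poincareIndexInfty (fun z => f z - η) =
      (preimages f S A η).ncard - poleCount f S A := by
  have hS : ∀ᶠ z in Bornology.cobounded ℂ, z ∉ S :=
    Bornology.isBounded_def.1 S.finite_toSet.isBounded
  obtain ⟨R₀, hR₀, hfar⟩ := exists_pos_forall_lt_norm ((hA.eventually_mem hf hb).and (hS.and hinf))
  have hindex : poincareIndexInfty (fun z => f z - η) =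
      ∑ j, windingNumber (fun t => f (γ j t)) (a j) (b j) η -
        ((preimages f S A η).ncard - poleCount f S A) := by
    refine (tendsto_const_nhds.congr' ?_).limUnder_eq
    filter_upwards [eventually_gt_atTop R₀] with R hR
    have hcircle (t : ℝ) : R₀ < ‖circleMap 0 R t‖ := by
      rwa [norm_circleMap_zero, abs_of_pos (hR₀.trans hR)]
    have hcont : Continuous fun t => f (circleMap 0 R t) - η :=
      continuous_iff_continuousAt.2 fun t =>
        ((hf.continuousAt (hfar _ (hcircle t)).2.1).comp
          (continuous_circleMap 0 R).continuousAt).sub_const η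
    have hreverse := winding_comp_const_sub (s := 0) Real.two_pi_pos.le hcont.continuousOn
      fun t _ => sub_ne_zero.2 (hfar _ (hcircle t)).2.2
    have hcount := hA.windingNumber_circleMap_add_sum_eq hf hη hγ hb hfin (hR₀.trans hR)
      (fun z hz => hfar z (hR.trans_le hz)) (0 - 2 * Real.pi)
    simp only [zero_sub, sub_zero, neg_add_cancel] at hreverse hcount
    rw [hreverse, ← hcount, windingNumber]
    ring
  rw [hindex]
  ring

end IsTile

end Count

end HarmonicCount

open HarmonicCount in
theorem theorem3p2 (f : ℂ → ℂ) (S : Finset ℂ) (hf : NonDegenerate f S) (η : ℂ)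
    (A : Set ℂ) (hA : IsTile f S A) (hη : ∀ z ∈ frontier A, f z ≠ η)
    (n : ℕ) (a b : Fin n → ℝ) (γ : Fin n → ℝ → ℂ)
    (hγ : IsCritParam f (frontier A \ exceptSet f S) a b γ) :
    (Bornology.IsBounded A →
      (preimages f S A η).Finite ∧
      ((preimages f S A η).ncard : ℝ) =
        (∑ j, windingNumber (fun t => f (γ j t)) (a j) (b j) η) + poleCount f S A) ∧
    (¬ Bornology.IsBounded A → (∀ᶠ z in Bornology.cobounded ℂ, f z ≠ η) →
      (preimages f S A η).Finite ∧
      ((preimages f S A η).ncard : ℝ) =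
        (∑ j, windingNumber (fun t => f (γ j t)) (a j) (b j) η) + poleCount f S A
          - poincareIndexInfty (fun z => f z - η)) := by
  refine ⟨fun hb => ?_, fun hb hinf => ?_⟩
  · have hfin := hA.finite_preimages hf hη (hb.subset fun z hz => hz.1)
    have hcount := hA.sum_windingNumber_eq_of_isBounded hf hη hγ hb hfin
    exact ⟨hfin, by linarith⟩
  · have hfin := hA.finite_preimages hf hη
      (Bornology.isBounded_def.2 (hinf.mono fun z hz hzp => hz hzp.2.2))
    have hcount := hA.sum_windingNumber_sub_poincareIndexInfty_eq hf hη hγ hb hinf hfin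
    exact ⟨hfin, by linarith⟩
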